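/- **Setting.** Fix $\mu_0>0$, let $S^1=\mathbb R/\tfrac{2\pi}{\mu_0}\mathbb Z$, and give $S^1\times\mathbb R^3$ (coordinates $(t,\vec x)$) the flat metric and the orientation $dt\wedge dx^1\wedge dx^2\wedge dx^3$. Let $S^2_\infty$ be the boundary sphere of the radial compactification of $\mathbb R^3$ to a closed ball, let $W_\infty=S^2_\infty\times\mathbb C^2=L_+\oplus L_-$ (the two coordinate line bundles), and let $\Phi_\infty=\mathrm{diag}(\imath\mu_0/4,-\imath\mu_0/4)$. *Calorons.* A framed connection is a pair $(A,f)$ of a smooth $SU(2)$ connection $d+A$ on the trivial rank 2 bundle over $S^1\times\mathbb R^3$ and a smooth framing $f:S^1\times S^2_\infty\to SU(2)$. Two pairs are equivalent, $[A,f]=[A',f']$, if there is a smooth $g:S^1\times\mathbb R^3\to SU(2)$ with $A'=gAg^{-1}-dg\,g^{-1}$ that tends, uniformly as $|\vec x|\to\infty$, to $f'^{-1}f$ on $S^1\times S^2_\infty$. Let $k\ge1$. A $(k,k)$-caloron with equal monopole masses $\nu_1=\nu_2=\mu_0/2$ is a class $[A,f]$ with a representative such that: the curvature satisfies $\star F=-F$;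 the action $-\int\mathrm{tr}(F\wedge\star F)$ is finite; $A$ extends smoothly to $S^1\times S^2_\infty$, where its restriction satisfies $fAf^{-1}-df\,f^{-1}=\Phi_\infty\,dt$; and the charge is $\frac1{8\pi^2}\int\mathrm{tr}(F\wedge F)=k$. The set of all such classes is $\mathcal C_k$. *Symmetries.* Let $J=\begin{pmatrix}0&1\\-1&0\end{pmatrix}$, which exchanges $L_+$ and $L_-$ and satisfies $J(-\Phi_\infty)J^{-1}=\Phi_\infty$. The following bijections act on classes of framed connections. - *Euclidean symmetries.* An isometry $E(t,\vec x)=(\pm t+s,R\vec x)$ with $R\in O(3)$ that preserves the orientation acts by pull-back, $[A,f]\mapsto[E^*A,E^*f]$, and by $[A,f]\mapsto[E^*A,J\,E^*f]$ if it reverses $t$. - *Phases.* For $\omega\in\mathbb R$, $P(\omega)[A,f]=[A,\mathrm{diag}(e^{\imath\omega},e^{-\imath\omega})f]$. - *The rotation map.* With the anti-periodic large gauge transformation $c(t)=\mathrm{diag}(e^{\imath\mu_0t/2},e^{-\imath\mu_0t/2})$, i.e. $e^{\pm\imath\mu_0t/2}$ on $L_\pm$, one sets $\rho[A,f]=[\,cAc^{-1}-dc\,c^{-1},\;J\,c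 f c^{-1}]$. Let $\mathcal S$ be the group generated by all of these. For a subgroup $H\subset\mathcal S$, a $(k,k)$-caloron is *$H$-symmetric* if it is fixed by every element of $H$, and $\mathcal C_k(H)$ denotes the set of $H$-symmetric $(k,k)$-calorons in $\mathcal C_k$. **Proposition.** Let $k\ge 1$ and let $H\subset\mathcal S$ be a subgroup with $P(\omega)\rho\in H$ for some $\omega\in\mathbb R$. Then $\mathcal C_k(H)=\emptyset$. -/

import Mathlib

open Filter Topology MeasureTheory
open scoped ContDiff

noncomputable section

namespace Caloron

/-! ### Space-time, `SU(2)` and `su(2)` -/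

/-- Complex `2 × 2` matrices, as a normed real algebra with the conjugate transpose as `star`.
(A type synonym of `Matrix (Fin 2) (Fin 2) ℂ`, because matrices carry no default norm in Mathlib.
The norm is only used for the calculus of matrix valued functions.) -/
def Mat : Type := Matrix (Fin 2) (Fin 2) ℂ

open scoped Matrix.Norms.Operator in
instance : NormedRing Mat := inferInstanceAs (NormedRing (Matrix (Fin 2) (Fin 2) ℂ))

open scoped Matrix.Norms.Operator in
instance : NormedAlgebra ℝ Mat :=
  inferInstanceAs (NormedAlgebra ℝ (Matrix (Fin 2) (Fin 2) ℂ))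

instance : StarRing Mat := inferInstanceAs (StarRing (Matrix (Fin 2) (Fin 2) ℂ))

instance : StarModule ℝ Mat := inferInstanceAs (StarModule ℝ (Matrix (Fin 2) (Fin 2) ℂ))

instance : ContinuousStar Mat :=
  ⟨(continuous_id.matrix_conjTranspose : Continuous fun X : Matrix (Fin 2) (Fin 2) ℂ => X.conjTranspose)⟩

/-- The trace. -/
def Mat.trace (X : Mat) : ℂ := Matrix.trace (X : Matrix (Fin 2) (Fin 2) ℂ)

/-- The determinant. -/
def Mat.det (X : Mat) : ℂ := Matrix.det (X : Matrix (Fin 2) (Fin 2) ℂ)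

/-- The matrix with the given entries. -/
def Mat.of (X : Matrix (Fin 2) (Fin 2) ℂ) : Mat := X

/-- Euclidean three-space. -/
abbrev Space : Type := EuclideanSpace ℝ (Fin 3)

/-- The universal cover `ℝ × ℝ³` of `S¹ × ℝ³`, with coordinates `(t, x)`. Objects on `S¹ × ℝ³` are
objects on the cover that are periodic in `t`. -/
abbrev Spacetime : Type := ℝ × Space

/-- The group `SU(2)`, as a set of matrices; the inverse of `g` is `star g`. -/
def SU2 : Submonoid Mat := Matrix.specialUnitaryGroup (Fin 2) ℂ

/-- The Lie algebra `su(2)`: trace-free skew-hermitian matrices. -/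
def IsSu2 (X : Mat) : Prop := star X = -X ∧ X.trace = 0

/-- The circumference `2π/μ₀` of the circle. -/
def period (μ₀ : ℝ) : ℝ := 2 * Real.pi / μ₀

/-- Spatial infinity `r → ∞`, uniformly in `t` and in the direction. -/
def spatialInfinity : Filter Spacetime := comap (fun p : Spacetime => ‖p.2‖) atTop

/-- The standard coordinate vector fields `∂₀ = ∂/∂t, ∂₁, ∂₂, ∂₃`. -/
def basisVec : Fin 4 → Spacetime :=
  Fin.cons ((1 : ℝ), (0 : Space)) fun i : Fin 3 => ((0 : ℝ), EuclideanSpace.single i (1 : ℝ))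

/-! ### Framed connections -/

/-- An `SU(2)` connection `d + A` on the trivial rank two bundle `V` over `S¹ × ℝ³`, together with
a framing `f : V|_∞ → p_∞^* W_∞` over `S¹ × S²_∞`, where `W_∞ = S²_∞ × ℂ²`.
A smooth map on `S¹ × S²` is encoded by its radial extension to `x ≠ 0`. -/
@[ext]
structure FramedConnection (μ₀ : ℝ) where
  /-- the connection one-form -/
  conn : Spacetime → Spacetime →L[ℝ] Mat
  /-- the framing, radially extended -/
  frame : Spacetime → Mat
  conn_smooth : ContDiff ℝ ∞ conn
  conn_su2 : ∀ p v, IsSu2 (conn p v)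
  conn_periodic : ∀ t x, conn (t + period μ₀, x) = conn (t, x)
  frame_smooth : ContDiffOn ℝ ∞ frame {p | p.2 ≠ 0}
  frame_SU2 : ∀ p, frame p ∈ SU2
  frame_periodic : ∀ t x, frame (t + period μ₀, x) = frame (t, x)
  frame_radial : ∀ t x, ∀ s : ℝ, 0 < s → frame (t, s • x) = frame (t, x)

/-- The gauge transformation `g` takes the connection `A` to `B = g A g⁻¹ - dg g⁻¹`. -/
def GaugeTakes (g : Spacetime → Mat) (A B : Spacetime → Spacetime →L[ℝ] Mat) : Prop :=
  ∀ p v, B p v = g p * A p v * star (g p) - fderiv ℝ g p v * star (g p)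

/-- Isomorphism of framed connections: a (periodic) gauge transformation `g` that intertwines the
connections, and which is the identity at `r = ∞` when it is read in the framings. If the two
framings agree, this is equivalence under a framed gauge transformation. -/
def GaugeEquiv {μ₀ : ℝ} (a b : FramedConnection μ₀) : Prop :=
  ∃ g : Spacetime → Mat, ContDiff ℝ ∞ g ∧ (∀ p, g p ∈ SU2) ∧
    (∀ t x, g (t + period μ₀, x) = g (t, x)) ∧ GaugeTakes g a.conn b.conn ∧
    Tendsto (fun p => b.frame p * g p * star (a.frame p)) spatialInfinity (𝓝 1)

lemma star_mul_of_SU2 {g : Mat} (h : g ∈ SU2) : star g * g = 1 :=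
  (Matrix.mem_specialUnitaryGroup_iff.1 h).1.1

lemma mul_star_of_SU2 {g : Mat} (h : g ∈ SU2) : g * star g = 1 :=
  (Matrix.mem_specialUnitaryGroup_iff.1 h).1.2

lemma star_mem_SU2 {g : Mat} (h : g ∈ SU2) : star g ∈ SU2 :=
  (star (⟨g, h⟩ : Matrix.specialUnitaryGroup (Fin 2) ℂ)).2

lemma gaugeTakes_iff {g : Spacetime → Mat} (hg : ∀ p, g p ∈ SU2)
    {A B : Spacetime → Spacetime →L[ℝ] Mat} :
    GaugeTakes g A B ↔ ∀ p v, fderiv ℝ g p v = g p * A p v - B p v * g p := by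
  refine forall₂_congr fun p v => ?_
  have h1 := star_mul_of_SU2 (hg p)
  have h2 := mul_star_of_SU2 (hg p)
  constructor
  · intro h
    rw [h, sub_mul, mul_assoc, mul_assoc _ (star (g p)), h1]
    simp
  · intro h
    rw [h, sub_mul, mul_assoc (B p v), h2]
    simp

lemma contDiff_star {g : Spacetime → Mat} (hg : ContDiff ℝ ∞ g) :
    ContDiff ℝ ∞ fun p => star (g p) :=
  (starL' ℝ : Mat ≃L[ℝ] Mat).contDiff.comp hg

lemma fderiv_star_mat {g : Spacetime → Mat} (hg : ContDiff ℝ ∞ g) (p v : Spacetime) :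
    fderiv ℝ (fun p => star (g p)) p v = star (fderiv ℝ g p v) := by
  have h := ((hg.differentiable (by simp)) p).hasFDerivAt.star
  rw [h.fderiv]
  simp

lemma fderiv_mul_mat {g h : Spacetime → Mat} (hg : ContDiff ℝ ∞ g) (hh : ContDiff ℝ ∞ h)
    (p v : Spacetime) :
    fderiv ℝ (fun p => g p * h p) p v = g p * fderiv ℝ h p v + fderiv ℝ g p v * h p := by
  have h' := ((hg.differentiable (by simp)) p).hasFDerivAt.mul'
    ((hh.differentiable (by simp)) p).hasFDerivAt
  have : fderiv ℝ (fun p => g p * h p) p = _ := h'.fderiv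
  rw [this]
  simp

lemma GaugeEquiv.refl {μ₀ : ℝ} (a : FramedConnection μ₀) : GaugeEquiv a a := by
  refine ⟨fun _ => 1, contDiff_const, fun _ => one_mem _, fun _ _ => rfl, ?_, ?_⟩
  · intro p v; simp
  · simp only [mul_one, mul_star_of_SU2 (a.frame_SU2 _)]
    exact tendsto_const_nhds

lemma GaugeEquiv.symm {μ₀ : ℝ} {a b : FramedConnection μ₀} (h : GaugeEquiv a b) :
    GaugeEquiv b a := by
  obtain ⟨g, hs, hU, hp, hA, hl⟩ := h
  refine ⟨fun p => star (g p), contDiff_star hs, fun p => star_mem_SU2 (hU p),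
    fun t x => by simp only [hp], ?_, ?_⟩
  · rw [gaugeTakes_iff hU] at hA
    rw [gaugeTakes_iff fun p => star_mem_SU2 (hU p)]
    intro p v
    rw [fderiv_star_mat hs, hA]
    simp only [star_sub, star_mul, (a.conn_su2 p v).1, (b.conn_su2 p v).1]
    noncomm_ring
  · have := hl.star
    simpa [star_mul, mul_assoc] using this

lemma GaugeEquiv.trans {μ₀ : ℝ} {a b c : FramedConnection μ₀} (h : GaugeEquiv a b)
    (h' : GaugeEquiv b c) : GaugeEquiv a c := by
  obtain ⟨g, hs, hU, hp, hA, hl⟩ := h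
  obtain ⟨k, ks, kU, kp, kA, kl⟩ := h'
  refine ⟨fun p => k p * g p, ks.mul hs, fun p => mul_mem (kU p) (hU p),
    fun t x => by simp only [hp, kp], ?_, ?_⟩
  · rw [gaugeTakes_iff hU] at hA
    rw [gaugeTakes_iff kU] at kA
    rw [gaugeTakes_iff fun p => mul_mem (kU p) (hU p)]
    intro p v
    rw [fderiv_mul_mat ks hs, hA, kA]
    noncomm_ring
  · have := kl.mul hl
    rw [one_mul] at this
    refine this.congr fun p => ?_
    rw [show c.frame p * k p * star (b.frame p) * (b.frame p * g p * star (a.frame p))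
      = c.frame p * k p * (star (b.frame p) * b.frame p) * g p * star (a.frame p) by noncomm_ring,
      star_mul_of_SU2 (b.frame_SU2 p)]
    noncomm_ring

instance framedSetoid (μ₀ : ℝ) : Setoid (FramedConnection μ₀) :=
  ⟨GaugeEquiv, GaugeEquiv.refl, GaugeEquiv.symm, GaugeEquiv.trans⟩

/-- Isomorphism classes of framed connections. -/
abbrev ModuliSpace (μ₀ : ℝ) : Type := Quotient (framedSetoid μ₀)

/-! ### Calorons -/

/-- The curvature `F = dA + A ∧ A`, evaluated on two vectors. -/
def curvature (A : Spacetime → Spacetime →L[ℝ] Mat) (p v w : Spacetime) : Mat :=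
  fderiv ℝ A p v w - fderiv ℝ A p w v + (A p v * A p w - A p w * A p v)

/-- The components `F_{ij} = F(∂_i, ∂_j)`. -/
def curvComp (A : Spacetime → Spacetime →L[ℝ] Mat) (i j : Fin 4) (p : Spacetime) : Mat :=
  curvature A p (basisVec i) (basisVec j)

/-- `⋆F = -F` for the flat metric and the orientation `dt ∧ dx¹ ∧ dx² ∧ dx³`. -/
def AntiSelfDual (A : Spacetime → Spacetime →L[ℝ] Mat) : Prop :=
  ∀ p, curvComp A 2 3 p = -curvComp A 0 1 p ∧ curvComp A 3 1 p = -curvComp A 0 2 p ∧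
    curvComp A 1 2 p = -curvComp A 0 3 p

/-- One period `[0, 2π/μ₀) × ℝ³`, a fundamental domain of `S¹ × ℝ³`. -/
def fundamentalDomain (μ₀ : ℝ) : Set Spacetime := {p | 0 ≤ p.1 ∧ p.1 < period μ₀}

/-- The Yang–Mills density `-tr (F ∧ ⋆F) = -∑_{i<j} tr (F_{ij}²)`. -/
def actionDensity (A : Spacetime → Spacetime →L[ℝ] Mat) (p : Spacetime) : ℝ :=
  -∑ i : Fin 4, ∑ j ∈ Finset.Ioi i, (curvComp A i j p * curvComp A i j p).trace.re

/-- The density `tr (F ∧ F)`. -/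
def chernDensity (A : Spacetime → Spacetime →L[ℝ] Mat) (p : Spacetime) : ℝ :=
  2 * (curvComp A 0 1 p * curvComp A 2 3 p + curvComp A 0 2 p * curvComp A 3 1 p
    + curvComp A 0 3 p * curvComp A 1 2 p).trace.re

/-- The caloron charge `Q = (1/8π²) ∫_{S¹ × ℝ³} tr (F ∧ F)`. -/
def charge (μ₀ : ℝ) (A : Spacetime → Spacetime →L[ℝ] Mat) : ℝ :=
  1 / (8 * Real.pi ^ 2) * ∫ p in fundamentalDomain μ₀, chernDensity A p

/-- The radial compactification: `(t, y) ↦ (t, y / (1 - |y|²))` is a diffeomorphism from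
`ℝ × (open unit ball)` onto `ℝ × ℝ³`, and near the unit sphere, which is `S²_∞`, the function
`1/r = (1 - |y|²)/|y|` is a smooth boundary defining function. -/
def ballChart (q : Spacetime) : Spacetime := (q.1, (1 - ‖q.2‖ ^ 2)⁻¹ • q.2)

/-- The Higgs field at infinity for equal monopole masses, `Φ_∞ = diag(iμ, -iμ)` with `μ = μ₀/4`
(so that `ν₁ = 2μ` and `ν₂ = μ₀ - 2μ` are both `μ₀/2`). The eigenbundles `L_+`, `L_-` are the two
coordinate line bundles of `W_∞ = S²_∞ × ℂ²`. -/
def higgsInfinity (μ₀ : ℝ) : Mat :=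
  Mat.of <| Matrix.diagonal ![Complex.I * (μ₀ / 4), -(Complex.I * (μ₀ / 4))]

/-- The boundary condition `A|_{S¹ × S²_∞} = Φ_∞ dt + a_∞`, read in the framing, for magnetic charge
zero, where `L_±` are trivial and `a_∞ = 0`: the connection extends smoothly to the
compactification `S¹ × (closed ball)`, and its pull-back to the boundary is the gauge transform by
`f⁻¹` of `Φ_∞ dt`, that is `f A f⁻¹ - df f⁻¹ = Φ_∞ dt` on all vectors tangent to the boundary. -/
def BoundaryCondition {μ₀ : ℝ} (a : FramedConnection μ₀) : Prop :=
  ∃ Abar : Spacetime → Spacetime →L[ℝ] Mat, ContDiff ℝ ∞ Abar ∧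
    (∀ q : Spacetime, ‖q.2‖ < 1 →
      Abar q = (a.conn (ballChart q)).comp (fderiv ℝ ballChart q)) ∧
    ∀ q v : Spacetime, ‖q.2‖ = 1 → inner ℝ q.2 v.2 = 0 →
      a.frame q * Abar q v * star (a.frame q) - fderiv ℝ a.frame q v * star (a.frame q)
        = v.1 • higgsInfinity μ₀

/-- Framed `(k,k)`-caloron configurations with equal masses: finite action anti-self-dual framed
connections satisfying the boundary condition, whose charge
`Q = (m₁ ν₁ + m₂ ν₂)/μ₀` is `k`. -/
structure IsCaloron {μ₀ : ℝ} (k : ℕ) (a : FramedConnection μ₀) : Prop where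
  asd : AntiSelfDual a.conn
  finite_action : IntegrableOn (actionDensity a.conn) (fundamentalDomain μ₀)
  boundary : BoundaryCondition a
  charge_eq : charge μ₀ a.conn = k

/-- The moduli space `𝒞_k` of framed `(k,k)`-calorons with equal masses. -/
def calorons (μ₀ : ℝ) (k : ℕ) : Set (ModuliSpace μ₀) :=
  {x | ∃ a : FramedConnection μ₀, IsCaloron k a ∧ (⟦a⟧ : ModuliSpace μ₀) = x}

/-! ### The symmetries -/

/-- `diag(e^{iθ}, e^{-iθ})`, i.e. multiplication by `e^{±iθ}` on `L_±`. -/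
def diagPhase (θ : ℝ) : Mat :=
  Mat.of <| Matrix.diagonal ![Complex.exp (Complex.I * θ), Complex.exp (-(Complex.I * θ))]

/-- The automorphism of `W_∞` which exchanges `L_+` and `L_-`. It is parallel for `a_∞` and takes
`-Φ_∞` to `Φ_∞`; these properties determine it up to a phase `diagPhase θ`. -/
def swap : Mat := Mat.of !![0, 1; -1, 0]

lemma diagPhase_mem (θ : ℝ) : diagPhase θ ∈ SU2 := by
  have h : (starRingEnd ℂ) (Complex.exp (Complex.I * θ)) = Complex.exp (-(Complex.I * θ)) := by
    rw [← Complex.exp_conj]; simp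
  have h' : (starRingEnd ℂ) (Complex.exp (-(Complex.I * θ))) = Complex.exp (Complex.I * θ) := by
    rw [← Complex.exp_conj]; simp
  refine Matrix.mem_specialUnitaryGroup_iff.2 ⟨Matrix.mem_unitaryGroup_iff.2 ?_, ?_⟩
  · ext i j
    fin_cases i <;> fin_cases j <;>
      simp [diagPhase, Mat.of, Matrix.star_eq_conjTranspose, Matrix.mul_apply, h, h',
        ← Complex.exp_add]
  · simp [diagPhase, Mat.of, Matrix.det_diagonal, ← Complex.exp_add]

lemma swap_mem : swap ∈ SU2 := by
  refine Matrix.mem_specialUnitaryGroup_iff.2 ⟨Matrix.mem_unitaryGroup_iff.2 ?_, ?_⟩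
  · ext i j
    fin_cases i <;> fin_cases j <;>
      simp [swap, Mat.of, Matrix.star_eq_conjTranspose, Matrix.mul_apply]
  · simp [swap, Mat.of, Matrix.det_fin_two]

lemma Mat.trace_mul_comm (X Y : Mat) : (X * Y).trace = (Y * X).trace :=
  Matrix.trace_mul_comm (X : Matrix (Fin 2) (Fin 2) ℂ) Y

lemma Mat.trace_sub (X Y : Mat) : (X - Y).trace = X.trace - Y.trace :=
  Matrix.trace_sub (X : Matrix (Fin 2) (Fin 2) ℂ) Y

lemma Mat.trace_smul (r : ℝ) (X : Mat) : (r • X).trace = r • X.trace :=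
  Matrix.trace_smul r (X : Matrix (Fin 2) (Fin 2) ℂ)

lemma IsSu2.conj {X g : Mat} (hX : IsSu2 X) (hg : g ∈ SU2) : IsSu2 (g * X * star g) := by
  refine ⟨?_, ?_⟩
  · simp [star_mul, hX.1, mul_assoc]
  · rw [Mat.trace_mul_comm, ← mul_assoc, star_mul_of_SU2 hg, one_mul, hX.2]

lemma IsSu2.sub {X Y : Mat} (hX : IsSu2 X) (hY : IsSu2 Y) : IsSu2 (X - Y) := by
  refine ⟨?_, ?_⟩
  · rw [star_sub, hX.1, hY.1]; abel
  · rw [Mat.trace_sub, hX.2, hY.2, sub_zero]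

lemma IsSu2.smul {X : Mat} (r : ℝ) (hX : IsSu2 X) : IsSu2 (r • X) := by
  refine ⟨?_, ?_⟩
  · rw [star_smul, hX.1]; simp
  · rw [Mat.trace_smul, hX.2, smul_zero]

/-- An isometry `(t, x) ↦ (± t + s, R x)` of `S¹ × ℝ³` with `R ∈ O(3)`, preserving the orientation:
an element of `(O(2) × O(3))₊`. -/
structure EuclideanIsometry where
  /-- the sign of the action on the circle -/
  sign : ℤˣ
  /-- the translation along the circle -/
  shift : ℝ
  /-- the action on `ℝ³` -/
  rot : Space ≃ₗᵢ[ℝ] Space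
  orientation : ((sign : ℤ) : ℝ) * LinearMap.det (rot.toLinearEquiv : Space →ₗ[ℝ] Space) = 1

namespace EuclideanIsometry

/-- The sign as a real number. -/
def sgn (E : EuclideanIsometry) : ℝ := ((E.sign : ℤ) : ℝ)

lemma sgn_eq (E : EuclideanIsometry) : E.sgn = 1 ∨ E.sgn = -1 := by
  rcases Int.units_eq_one_or E.sign with h | h <;> simp [sgn, h]

lemma sgn_mul_self (E : EuclideanIsometry) : E.sgn * E.sgn = 1 := by
  rcases E.sgn_eq with h | h <;> simp [h]

/-- The isometry as a map. -/
def toFun (E : EuclideanIsometry) (p : Spacetime) : Spacetime := (E.sgn * p.1 + E.shift, E.rot p.2)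

/-- The (constant) differential of the isometry. -/
def lin (E : EuclideanIsometry) : Spacetime →L[ℝ] Spacetime :=
  (E.sgn • ContinuousLinearMap.id ℝ ℝ).prodMap
    (E.rot.toContinuousLinearEquiv : Space →L[ℝ] Space)

/-- The inverse isometry. -/
def inv (E : EuclideanIsometry) : EuclideanIsometry where
  sign := E.sign
  shift := -(E.sgn * E.shift)
  rot := E.rot.symm
  orientation := by
    have h := E.orientation
    have hs : ((E.sign : ℤ) : ℝ) * ((E.sign : ℤ) : ℝ) = 1 := E.sgn_mul_self
    have h2 : LinearMap.det (E.rot.symm.toLinearEquiv : Space →ₗ[ℝ] Space)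
        * LinearMap.det (E.rot.toLinearEquiv : Space →ₗ[ℝ] Space) = 1 := by
      rw [← LinearMap.det_comp]
      have : (E.rot.symm.toLinearEquiv : Space →ₗ[ℝ] Space) ∘ₗ
          (E.rot.toLinearEquiv : Space →ₗ[ℝ] Space) = LinearMap.id := by
        ext1 x; simp
      rw [this, LinearMap.det_id]
    linear_combination h2 - LinearMap.det (E.rot.symm.toLinearEquiv : Space →ₗ[ℝ] Space) *
      (((E.sign : ℤ) : ℝ) * h - LinearMap.det (E.rot.toLinearEquiv : Space →ₗ[ℝ] Space) * hs)

lemma toFun_inv (E : EuclideanIsometry) (p : Spacetime) : E.toFun (E.inv.toFun p) = p := by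
  have h := E.sgn_mul_self
  ext1
  · change E.sgn * (E.sgn * p.1 + -(E.sgn * E.shift)) + E.shift = p.1
    linear_combination (p.1 - E.shift) * h
  · exact E.rot.apply_symm_apply p.2

lemma inv_toFun (E : EuclideanIsometry) (p : Spacetime) : E.inv.toFun (E.toFun p) = p := by
  have h := E.sgn_mul_self
  ext1
  · change E.sgn * (E.sgn * p.1 + E.shift) + -(E.sgn * E.shift) = p.1
    linear_combination p.1 * h
  · exact E.rot.symm_apply_apply p.2

lemma lin_inv (E : EuclideanIsometry) (v : Spacetime) : E.lin (E.inv.lin v) = v := by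
  have h := E.sgn_mul_self
  ext1
  · change E.sgn * (E.sgn * v.1) = v.1
    linear_combination v.1 * h
  · exact E.rot.apply_symm_apply v.2

lemma inv_lin (E : EuclideanIsometry) (v : Spacetime) : E.inv.lin (E.lin v) = v := by
  have h := E.sgn_mul_self
  ext1
  · change E.sgn * (E.sgn * v.1) = v.1
    linear_combination v.1 * h
  · exact E.rot.symm_apply_apply v.2

lemma toFun_eq (E : EuclideanIsometry) : E.toFun = fun p => E.lin p + (E.shift, 0) := by
  funext p
  ext1
  · rfl
  · exact (add_zero (E.rot p.2)).symm

lemma hasFDerivAt (E : EuclideanIsometry) (p : Spacetime) : HasFDerivAt E.toFun E.lin p := by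
  rw [toFun_eq]
  exact E.lin.hasFDerivAt.add_const _

lemma contDiff (E : EuclideanIsometry) : ContDiff ℝ ∞ E.toFun := by
  rw [toFun_eq]
  exact E.lin.contDiff.add contDiff_const

lemma periodic {α : Type*} {φ : Spacetime → α} {T : ℝ} (hφ : ∀ t x, φ (t + T, x) = φ (t, x))
    (E : EuclideanIsometry) (t : ℝ) (x : Space) : φ (E.toFun (t + T, x)) = φ (E.toFun (t, x)) := by
  simp only [toFun]
  rcases E.sgn_eq with h | h
  · rw [h, ← hφ (1 * t + E.shift)]
    congr 2; ring
  · rw [h, ← hφ (-1 * (t + T) + E.shift)]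
    congr 2; ring

lemma tendsto_spatialInfinity (E : EuclideanIsometry) :
    Tendsto E.toFun spatialInfinity spatialInfinity := by
  refine tendsto_comap_iff.2 ?_
  have : (fun p : Spacetime => ‖p.2‖) ∘ E.toFun = fun p => ‖p.2‖ := by
    funext p; exact E.rot.norm_map p.2
  rw [this]
  exact tendsto_comap

end EuclideanIsometry

/-- The identity isometry. -/
def EuclideanIsometry.id : EuclideanIsometry :=
  ⟨1, 0, LinearIsometryEquiv.refl ℝ Space, by
    have : ((LinearIsometryEquiv.refl ℝ Space).toLinearEquiv : Space →ₗ[ℝ] Space)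
      = LinearMap.id := rfl
    rw [this]; simp⟩

namespace FramedConnection

variable {μ₀ : ℝ}

/-- Pull-back of the connection and of the framing by a euclidean isometry, followed by the constant
automorphism `K` of `W_∞`: `(A, f) ↦ (E^* A, K ∘ E^* f)`. -/
def pullback (E : EuclideanIsometry) (K : Mat) (hK : K ∈ SU2) (a : FramedConnection μ₀) :
    FramedConnection μ₀ where
  conn p := (a.conn (E.toFun p)).comp E.lin
  frame p := K * a.frame (E.toFun p)
  conn_smooth := (a.conn_smooth.comp E.contDiff).clm_comp contDiff_const
  conn_su2 p v := a.conn_su2 _ _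
  conn_periodic t x := by rw [EuclideanIsometry.periodic a.conn_periodic]
  frame_smooth := by
    refine contDiffOn_const.mul (a.frame_smooth.comp E.contDiff.contDiffOn ?_)
    intro p hp h
    exact hp (by simpa [EuclideanIsometry.toFun] using h)
  frame_SU2 p := mul_mem hK (a.frame_SU2 _)
  frame_periodic t x := by rw [EuclideanIsometry.periodic a.frame_periodic]
  frame_radial t x s hs := by
    simp only [EuclideanIsometry.toFun, map_smul, a.frame_radial _ _ s hs]

lemma pullback_equiv (E : EuclideanIsometry) {K : Mat} (hK : K ∈ SU2) {a b : FramedConnection μ₀}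
    (h : GaugeEquiv a b) : GaugeEquiv (a.pullback E K hK) (b.pullback E K hK) := by
  obtain ⟨g, hs, hU, hp, hA, hl⟩ := h
  refine ⟨g ∘ E.toFun, hs.comp E.contDiff, fun p => hU _, EuclideanIsometry.periodic hp E, ?_, ?_⟩
  · intro p v
    have := ((hs.differentiable (by simp)) (E.toFun p)).hasFDerivAt.comp p (E.hasFDerivAt p)
    rw [this.fderiv]
    exact hA (E.toFun p) (E.lin v)
  · have := ((hl.comp E.tendsto_spatialInfinity).const_mul K).mul_const (star K)
    rw [mul_one, mul_star_of_SU2 hK] at this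
    refine this.congr fun p => ?_
    simp [pullback, star_mul, mul_assoc]

/-- `pullback` as a bijection. -/
def pullbackEquiv (E : EuclideanIsometry) (K : Mat) (hK : K ∈ SU2) :
    FramedConnection μ₀ ≃ FramedConnection μ₀ where
  toFun := pullback E K hK
  invFun := pullback E.inv (star K) (star_mem_SU2 hK)
  left_inv a := by
    apply FramedConnection.ext
    · funext p
      refine ContinuousLinearMap.ext fun v => ?_
      simp [pullback, E.toFun_inv, E.lin_inv]
    · funext p
      simp [pullback, ← mul_assoc, star_mul_of_SU2 hK, E.toFun_inv]
  right_inv a := by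
    apply FramedConnection.ext
    · funext p
      refine ContinuousLinearMap.ext fun v => ?_
      simp [pullback, E.inv_toFun, E.inv_lin]
    · funext p
      simp [pullback, ← mul_assoc, mul_star_of_SU2 hK, E.inv_toFun]

end FramedConnection

/-- The large gauge transformation `c(t) = diag(e^{iμ₀t/2}, e^{-iμ₀t/2})`, which is
anti-periodic, `c(t + 2π/μ₀) = -c(t)`. -/
def largeGauge (μ₀ : ℝ) (p : Spacetime) : Mat := diagPhase (μ₀ / 2 * p.1)

/-- The logarithmic derivative `(dc/dt) c⁻¹ = diag(iμ₀/2, -iμ₀/2)` of `largeGauge`. -/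
def largeGaugeLog (μ₀ : ℝ) : Mat :=
  Mat.of <| Matrix.diagonal ![Complex.I * (μ₀ / 2), -(Complex.I * (μ₀ / 2))]

lemma diagPhase_add (α β : ℝ) : diagPhase (α + β) = diagPhase α * diagPhase β := by
  refine Eq.trans ?_ (Matrix.diagonal_mul_diagonal _ _).symm
  simp only [diagPhase, Mat.of]
  congr 1
  ext i
  fin_cases i <;> simp [← Complex.exp_add] <;> ring_nf

lemma diagPhase_zero : diagPhase 0 = 1 := by
  refine Eq.trans ?_ Matrix.diagonal_one
  simp only [diagPhase, Mat.of]
  congr 1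
  ext i
  fin_cases i <;> simp

lemma diagPhase_pi : diagPhase Real.pi = -1 := by
  have : Matrix.diagonal ![Complex.exp (Complex.I * Real.pi),
      Complex.exp (-(Complex.I * Real.pi))] = (-1 : Matrix (Fin 2) (Fin 2) ℂ) := by
    ext i j
    fin_cases i <;> fin_cases j <;> simp [mul_comm Complex.I, Complex.exp_neg]
  exact this

lemma star_diagPhase (α : ℝ) : star (diagPhase α) = diagPhase (-α) := by
  have h : diagPhase (-α) * diagPhase α = 1 := by
    rw [← diagPhase_add, neg_add_cancel, diagPhase_zero]
  calc star (diagPhase α) = diagPhase (-α) * diagPhase α * star (diagPhase α) := by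
        rw [h, one_mul]
    _ = diagPhase (-α) := by rw [mul_assoc, mul_star_of_SU2 (diagPhase_mem α), mul_one]

lemma swap_mul_diagPhase (α : ℝ) : swap * diagPhase α = diagPhase (-α) * swap := by
  have : (!![0, 1; -1, 0] : Matrix (Fin 2) (Fin 2) ℂ) *
      Matrix.diagonal ![Complex.exp (Complex.I * α), Complex.exp (-(Complex.I * α))] =
      Matrix.diagonal ![Complex.exp (Complex.I * (-α : ℝ)),
        Complex.exp (-(Complex.I * (-α : ℝ)))] * !![0, 1; -1, 0] := by
    ext i j
    fin_cases i <;> fin_cases j <;> simp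
  exact this

lemma swap_mul_swap : swap * swap = -1 := by
  have : (!![0, 1; -1, 0] : Matrix (Fin 2) (Fin 2) ℂ) * !![0, 1; -1, 0] = -1 := by
    ext i j
    fin_cases i <;> fin_cases j <;> simp
  exact this

lemma largeGaugeLog_su2 (μ₀ : ℝ) : IsSu2 (largeGaugeLog μ₀) := by
  refine ⟨?_, ?_⟩
  · have : (Matrix.diagonal ![Complex.I * (μ₀ / 2), -(Complex.I * (μ₀ / 2))]).conjTranspose =
        -(Matrix.diagonal ![Complex.I * (μ₀ / 2), -(Complex.I * (μ₀ / 2))] :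
          Matrix (Fin 2) (Fin 2) ℂ) := by
      ext i j
      fin_cases i <;> fin_cases j <;> simp
    exact this
  · refine (Matrix.trace_diagonal _).trans ?_
    simp

lemma diagPhase_eq (θ : ℝ) : diagPhase θ =
    Real.cos θ • (1 : Mat) + Real.sin θ • Mat.of (Matrix.diagonal ![Complex.I, -Complex.I]) := by
  have : Matrix.diagonal ![Complex.exp (Complex.I * θ), Complex.exp (-(Complex.I * θ))] =
      Real.cos θ • (1 : Matrix (Fin 2) (Fin 2) ℂ)
        + Real.sin θ • Matrix.diagonal ![Complex.I, -Complex.I] := by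
    have h1 : Complex.exp (Complex.I * θ) = Complex.cos θ + Complex.sin θ * Complex.I := by
      rw [mul_comm, Complex.exp_mul_I]
    have h2 : Complex.exp (-(Complex.I * θ)) = Complex.cos θ - Complex.sin θ * Complex.I := by
      rw [← mul_neg, mul_comm, Complex.exp_mul_I, Complex.cos_neg, Complex.sin_neg]; ring
    ext i j
    fin_cases i <;> fin_cases j <;> simp [h1, h2] <;> ring
  exact this

lemma largeGaugeLog_eq (μ₀ : ℝ) : largeGaugeLog μ₀ =
    (μ₀ / 2) • Mat.of (Matrix.diagonal ![Complex.I, -Complex.I]) := by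
  have : Matrix.diagonal ![Complex.I * (μ₀ / 2), -(Complex.I * (μ₀ / 2))] =
      (μ₀ / 2) • (Matrix.diagonal ![Complex.I, -Complex.I] : Matrix (Fin 2) (Fin 2) ℂ) := by
    ext i j
    fin_cases i <;> fin_cases j <;> (simp; try ring)
  exact this

lemma sigma_sq : Mat.of (Matrix.diagonal ![Complex.I, -Complex.I]) *
    Mat.of (Matrix.diagonal ![Complex.I, -Complex.I]) = -1 := by
  have : Matrix.diagonal ![Complex.I, -Complex.I] * Matrix.diagonal ![Complex.I, -Complex.I] =
      (-1 : Matrix (Fin 2) (Fin 2) ℂ) := by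
    ext i j
    fin_cases i <;> fin_cases j <;> simp
  exact this

lemma largeGauge_contDiff (μ₀ : ℝ) : ContDiff ℝ ∞ (largeGauge μ₀) := by
  unfold largeGauge
  simp only [diagPhase_eq]
  have h : ContDiff ℝ ∞ fun p : Spacetime => μ₀ / 2 * p.1 := contDiff_const.mul contDiff_fst
  exact ((Real.contDiff_cos.comp h).smul contDiff_const).add
    ((Real.contDiff_sin.comp h).smul contDiff_const)

lemma largeGauge_fderiv (μ₀ : ℝ) (p v : Spacetime) :
    fderiv ℝ (largeGauge μ₀) p v = v.1 • (largeGaugeLog μ₀ * largeGauge μ₀ p) := by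
  have h : HasFDerivAt (fun p : Spacetime => μ₀ / 2 * p.1)
      ((μ₀ / 2) • ContinuousLinearMap.fst ℝ ℝ Space) p :=
    (ContinuousLinearMap.fst ℝ ℝ Space).hasFDerivAt.const_mul (μ₀ / 2)
  have h' := (h.cos.smul_const (1 : Mat)).add
    (h.sin.smul_const (Mat.of (Matrix.diagonal ![Complex.I, -Complex.I])))
  have e : largeGauge μ₀ = (fun p : Spacetime => Real.cos (μ₀ / 2 * p.1) • (1 : Mat)) +
      fun p => Real.sin (μ₀ / 2 * p.1) • Mat.of (Matrix.diagonal ![Complex.I, -Complex.I]) := by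
    funext p; exact diagPhase_eq _
  rw [← e] at h'
  rw [h'.fderiv, largeGauge, diagPhase_eq, largeGaugeLog_eq]
  simp only [mul_add, smul_mul_assoc, mul_smul_comm, mul_one, sigma_sq]
  simp only [add_apply, ContinuousLinearMap.smulRight_apply, smul_apply,
    ContinuousLinearMap.coe_fst', smul_eq_mul]
  module

lemma largeGauge_period (μ₀ t : ℝ) (x : Space) :
    largeGauge μ₀ (t + period μ₀, x) = largeGauge μ₀ (t, x) ∨
      largeGauge μ₀ (t + period μ₀, x) = -largeGauge μ₀ (t, x) := by
  simp only [largeGauge, mul_add, diagPhase_add]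
  by_cases h : μ₀ = 0
  · left; simp [h, diagPhase_zero]
  · right
    rw [show μ₀ / 2 * period μ₀ = Real.pi by unfold period; field_simp, diagPhase_pi]
    simp

lemma largeGauge_conj_period (μ₀ t : ℝ) (x : Space) (X : Mat) :
    largeGauge μ₀ (t + period μ₀, x) * X * star (largeGauge μ₀ (t + period μ₀, x)) =
      largeGauge μ₀ (t, x) * X * star (largeGauge μ₀ (t, x)) := by
  rcases largeGauge_period μ₀ t x with h | h <;> simp [h]

lemma largeGauge_mem (μ₀ : ℝ) (p : Spacetime) : largeGauge μ₀ p ∈ SU2 := diagPhase_mem _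

lemma diagPhase_norm_le : ∃ C : ℝ, ∀ θ, ‖diagPhase θ‖ ≤ C := by
  refine ⟨‖(1 : Mat)‖ + ‖Mat.of (Matrix.diagonal ![Complex.I, -Complex.I])‖, fun θ => ?_⟩
  rw [diagPhase_eq]
  refine (norm_add_le _ _).trans (add_le_add ?_ ?_) <;> rw [norm_smul]
  · exact mul_le_of_le_one_left (norm_nonneg _) (Real.abs_cos_le_one θ)
  · exact mul_le_of_le_one_left (norm_nonneg _) (Real.abs_sin_le_one θ)

lemma tendsto_conj_diagPhase {l : Filter Spacetime} {X : Spacetime → Mat} (θ : Spacetime → ℝ)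
    (h : Tendsto X l (𝓝 1)) :
    Tendsto (fun p => diagPhase (θ p) * X p * star (diagPhase (θ p))) l (𝓝 1) := by
  obtain ⟨C, hC⟩ := diagPhase_norm_le
  have hC0 : 0 ≤ C := (norm_nonneg _).trans (hC 0)
  have h0 := tendsto_iff_norm_sub_tendsto_zero.1 h
  refine tendsto_iff_norm_sub_tendsto_zero.2 ?_
  refine squeeze_zero (fun p => norm_nonneg _) (g := fun p => C * ‖X p - 1‖ * C) (fun p => ?_) ?_
  · have : diagPhase (θ p) * X p * star (diagPhase (θ p)) - 1 =
        diagPhase (θ p) * (X p - 1) * star (diagPhase (θ p)) := by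
      rw [mul_sub, sub_mul, mul_one, mul_star_of_SU2 (diagPhase_mem _)]
    rw [this]
    refine (norm_mul_le _ _).trans (mul_le_mul ((norm_mul_le _ _).trans ?_) ?_ (norm_nonneg _) ?_)
    · exact mul_le_mul_of_nonneg_right (hC _) (norm_nonneg _)
    · rw [star_diagPhase]; exact hC _
    · positivity
  · simpa using (h0.const_mul C).mul_const C

namespace FramedConnection

variable {μ₀ : ℝ}

/-- The rotation map on framed connections. The connection `A` becomes its transform
`c A c⁻¹ - dc c⁻¹` under the large gauge transformation `c`, and the framing `f` becomes
`c f c⁻¹`; up to a periodic gauge transformation this is the large gauge transformation of `A`, with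
the framing kept, by any `σ` with `σ(t + 2π/μ₀) = -σ(t)` and `f σ f⁻¹ = e^{±iμ₀t/2}` on
`L_±` at infinity. It turns the boundary value `Φ_∞ dt` into `-Φ_∞ dt`, that is, it exchanges the
roles of `L_+` and `L_-`; the final `swap` identifies the result with a connection framed
by the original data `Φ_∞`. -/
def rotate (a : FramedConnection μ₀) : FramedConnection μ₀ where
  conn p := (ContinuousLinearMap.mulLeftRight ℝ Mat (largeGauge μ₀ p)
      (star (largeGauge μ₀ p))).comp (a.conn p)
    - (ContinuousLinearMap.fst ℝ ℝ Space).smulRight (largeGaugeLog μ₀)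
  frame p := swap * (largeGauge μ₀ p * a.frame p * star (largeGauge μ₀ p))
  conn_smooth := by
    refine ContDiff.sub (ContDiff.clm_comp ?_ a.conn_smooth) contDiff_const
    exact ((ContinuousLinearMap.mulLeftRight ℝ Mat).contDiff.comp
      (largeGauge_contDiff μ₀)).clm_apply (contDiff_star (largeGauge_contDiff μ₀))
  conn_su2 p v := ((a.conn_su2 p v).conj (largeGauge_mem μ₀ p)).sub
    ((largeGaugeLog_su2 μ₀).smul v.1)
  conn_periodic t x := by
    refine ContinuousLinearMap.ext fun v => ?_
    simp [a.conn_periodic, largeGauge_conj_period]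
  frame_smooth := contDiffOn_const.mul (((largeGauge_contDiff μ₀).contDiffOn.mul
    a.frame_smooth).mul (contDiff_star (largeGauge_contDiff μ₀)).contDiffOn)
  frame_SU2 p := mul_mem swap_mem (mul_mem (mul_mem (largeGauge_mem μ₀ p) (a.frame_SU2 p))
    (star_mem_SU2 (largeGauge_mem μ₀ p)))
  frame_periodic t x := by rw [largeGauge_conj_period, a.frame_periodic]
  frame_radial t x s hs := by
    rw [a.frame_radial t x s hs]; rfl

lemma rotate_conn (a : FramedConnection μ₀) (p v : Spacetime) : a.rotate.conn p v =
    largeGauge μ₀ p * a.conn p v * star (largeGauge μ₀ p) - v.1 • largeGaugeLog μ₀ := by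
  simp [rotate]

/-- The rotation map is the gauge transformation by the anti-periodic map `c`. -/
lemma rotate_gaugeTakes (a : FramedConnection μ₀) :
    GaugeTakes (largeGauge μ₀) a.conn a.rotate.conn := by
  intro p v
  rw [rotate_conn, largeGauge_fderiv, smul_mul_assoc, mul_assoc (largeGaugeLog μ₀),
    mul_star_of_SU2 (largeGauge_mem μ₀ p), mul_one]

lemma rotate_equiv {a b : FramedConnection μ₀} (h : GaugeEquiv a b) :
    GaugeEquiv a.rotate b.rotate := by
  obtain ⟨g, hs, hU, hp, hA, hl⟩ := h
  have hc := largeGauge_contDiff μ₀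
  have cU := largeGauge_mem μ₀
  have gU : ∀ p, largeGauge μ₀ p * g p * star (largeGauge μ₀ p) ∈ SU2 := fun p =>
    mul_mem (mul_mem (cU p) (hU p)) (star_mem_SU2 (cU p))
  refine ⟨fun p => largeGauge μ₀ p * g p * star (largeGauge μ₀ p),
    (hc.mul hs).mul (contDiff_star hc), gU, fun t x => ?_, ?_, ?_⟩
  · simp only [hp, largeGauge_conj_period]
  · rw [gaugeTakes_iff gU]
    intro p v
    have ha := (gaugeTakes_iff cU).1 a.rotate_gaugeTakes p v
    have hb := (gaugeTakes_iff cU).1 b.rotate_gaugeTakes p v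
    have hg := (gaugeTakes_iff hU).1 hA p v
    rw [fderiv_mul_mat (hc.mul hs) (contDiff_star hc), fderiv_mul_mat hc hs,
      fderiv_star_mat hc, hg]
    nth_rewrite 1 [ha]
    rw [hb]
    simp only [star_sub, star_mul, (a.conn_su2 p v).1, (a.rotate.conn_su2 p v).1]
    noncomm_ring
  · have h1 := ((tendsto_conj_diagPhase (fun p => μ₀ / 2 * p.1) hl).const_mul swap).mul_const
      (star swap)
    rw [mul_one, mul_star_of_SU2 swap_mem] at h1
    refine h1.congr fun p => ?_
    change swap * (largeGauge μ₀ p * (b.frame p * g p * star (a.frame p)) *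
      star (largeGauge μ₀ p)) * star swap = swap * (largeGauge μ₀ p * b.frame p *
        star (largeGauge μ₀ p)) * (largeGauge μ₀ p * g p * star (largeGauge μ₀ p)) *
        star (swap * (largeGauge μ₀ p * a.frame p * star (largeGauge μ₀ p)))
    have e := star_mul_of_SU2 (cU p)
    simp only [star_mul, star_star, mul_assoc]
    rw [← mul_assoc (star (largeGauge μ₀ p)) (largeGauge μ₀ p), e, one_mul,
      ← mul_assoc (star (largeGauge μ₀ p)) (largeGauge μ₀ p), e, one_mul]

lemma rotate_rotate (a : FramedConnection μ₀) : GaugeEquiv a a.rotate.rotate := by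
  have hc := largeGauge_contDiff μ₀
  have cU := largeGauge_mem μ₀
  have ncU : ∀ p, -largeGauge μ₀ p ∈ SU2 := fun p => by
    rw [← one_mul (largeGauge μ₀ p), ← neg_mul, ← diagPhase_pi]
    exact mul_mem (diagPhase_mem _) (cU p)
  have gU : ∀ p, -largeGauge μ₀ p * largeGauge μ₀ p ∈ SU2 := fun p => mul_mem (ncU p) (cU p)
  refine ⟨fun p => -largeGauge μ₀ p * largeGauge μ₀ p, hc.neg.mul hc, gU, fun t x => ?_, ?_, ?_⟩
  · rcases largeGauge_period μ₀ t x with h | h <;> simp [h]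
  · rw [gaugeTakes_iff gU]
    intro p v
    have h1 := (gaugeTakes_iff cU).1 a.rotate_gaugeTakes p v
    have h2 := (gaugeTakes_iff cU).1 a.rotate.rotate_gaugeTakes p v
    rw [fderiv_mul_mat hc.neg hc]
    have h3 : fderiv ℝ (fun p => -largeGauge μ₀ p) p v = -fderiv ℝ (largeGauge μ₀) p v := by
      rw [fderiv_fun_neg]; simp
    rw [h3, h2]
    nth_rewrite 1 [← h2]
    rw [h1]
    noncomm_ring
  · refine tendsto_const_nhds.congr fun p => ?_
    change 1 = swap * (largeGauge μ₀ p * (swap * (largeGauge μ₀ p * a.frame p *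
      star (largeGauge μ₀ p))) * star (largeGauge μ₀ p)) * (-largeGauge μ₀ p * largeGauge μ₀ p) *
        star (a.frame p)
    have e := star_mul_of_SU2 (cU p)
    have e1 : swap * largeGauge μ₀ p = star (largeGauge μ₀ p) * swap := by
      rw [largeGauge, star_diagPhase, swap_mul_diagPhase]
    have e2 : swap * (largeGauge μ₀ p * (swap * (largeGauge μ₀ p * a.frame p *
        star (largeGauge μ₀ p))) * star (largeGauge μ₀ p)) * (-largeGauge μ₀ p * largeGauge μ₀ p) *
        star (a.frame p) = -((swap * largeGauge μ₀ p) * (swap * largeGauge μ₀ p) * a.frame p *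
        star (largeGauge μ₀ p) * (star (largeGauge μ₀ p) * largeGauge μ₀ p) * largeGauge μ₀ p *
        star (a.frame p)) := by noncomm_ring
    have e3 : (swap * largeGauge μ₀ p) * (swap * largeGauge μ₀ p) = -1 := by
      nth_rewrite 2 [e1]
      rw [mul_assoc, ← mul_assoc (largeGauge μ₀ p), mul_star_of_SU2 (cU p), one_mul, swap_mul_swap]
    rw [e2, e3, e, mul_one, mul_assoc _ (star (largeGauge μ₀ p)), e, mul_one, neg_one_mul, neg_mul,
      mul_star_of_SU2 (a.frame_SU2 p), neg_neg]

end FramedConnection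

/-- The transformation of the moduli space induced by `pullbackEquiv`. -/
def pullbackPerm (μ₀ : ℝ) (E : EuclideanIsometry) (K : Mat) (hK : K ∈ SU2) :
    Equiv.Perm (ModuliSpace μ₀) :=
  Quotient.congr (FramedConnection.pullbackEquiv E K hK) fun a b =>
    ⟨fun h => FramedConnection.pullback_equiv E hK h, fun h => by
      have h' := FramedConnection.pullback_equiv E.inv (star_mem_SU2 hK) h
      have e : ∀ c : FramedConnection μ₀, (FramedConnection.pullbackEquiv E K hK c).pullback E.inv
          (star K) (star_mem_SU2 hK) = c := (FramedConnection.pullbackEquiv E K hK).left_inv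
      rw [e, e] at h'
      exact h'⟩

/-- The phase `P(θ)`: the framing is multiplied by `e^{±iθ}` on `L_±`. Up to a gauge transformation
this is the action on the connection, with the framing kept, of any automorphism of `V` equal to
`e^{±iθ}` on `L_±` at infinity. -/
def phase (μ₀ θ : ℝ) : Equiv.Perm (ModuliSpace μ₀) :=
  pullbackPerm μ₀ EuclideanIsometry.id (diagPhase θ) (diagPhase_mem θ)

/-- The action of `(O(2) × O(3))₊` by pull-back. An isometry that reverses the circle turns
`Φ_∞ dt` into `-Φ_∞ dt`, and is followed by the exchange of `L_+` and `L_-`. -/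
def euclidean (μ₀ : ℝ) (E : EuclideanIsometry) : Equiv.Perm (ModuliSpace μ₀) :=
  if E.sign = 1 then pullbackPerm μ₀ E 1 (one_mem _) else pullbackPerm μ₀ E swap swap_mem

/-- The rotation map `ρ`, an involution of the moduli space. -/
def rotation (μ₀ : ℝ) : Equiv.Perm (ModuliSpace μ₀) :=
  Function.Involutive.toPerm
    (Quotient.map FramedConnection.rotate fun _ _ h => FramedConnection.rotate_equiv h) fun x =>
      Quotient.inductionOn x fun a => Quotient.sound (FramedConnection.rotate_rotate a).symm

/-- The symmetry group `𝒮`, generated by the euclidean symmetries, the phases and the rotation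
map. -/
def symmetryGroup (μ₀ : ℝ) : Subgroup (Equiv.Perm (ModuliSpace μ₀)) :=
  Subgroup.closure (Set.range (euclidean μ₀) ∪ Set.range (phase μ₀) ∪ {rotation μ₀})

/-- The set `𝒞_k(H)` of `H`-symmetric `(k,k)`-calorons. -/
def symmetricCalorons (μ₀ : ℝ) (k : ℕ) (H : Subgroup (Equiv.Perm (ModuliSpace μ₀))) :
    Set (ModuliSpace μ₀) :=
  {x | x ∈ calorons μ₀ k ∧ ∀ h ∈ H, h x = x}

end Caloron

end

/-!
Let `c` be the large gauge transformation defining `ρ`. If `P(θ) ρ` fixes `[A, f]`, a periodic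
gauge transformation `g` takes `A` to its transform under `c`, so `h = c⁻¹ g` is parallel for `A`
and, like `c`, changes sign around the circle. Its trace is constant and changes sign, hence
vanishes. The curvature `F` commutes with `h`, and two trace-free `2 × 2` matrices anticommute up
to the trace of their product, so `F = 0` as soon as the two-form `tr (F h)` vanishes. By the
Bianchi identity this form is closed, and it is anti-self-dual, so its coefficients are harmonic.
They are periodic on the double cover of the circle, and they vanish at spatial infinity because
`A` extends to the radial compactification, where vectors tangent to `ℝ³` shrink to zero; the
maximum principle then shows that they are zero. So `A` is flat, and its charge is `0`.
-/

noncomputable section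

namespace Caloron

/-! ### Linear algebra -/

instance : FiniteDimensional ℝ Mat :=
  inferInstanceAs (FiniteDimensional ℝ (Matrix (Fin 2) (Fin 2) ℂ))

lemma Mat.trace_add (X Y : Mat) : (X + Y).trace = X.trace + Y.trace :=
  Matrix.trace_add (X : Matrix (Fin 2) (Fin 2) ℂ) Y

/-- The trace as a continuous linear map. -/
def traceCLM : Mat →L[ℝ] ℂ :=
  LinearMap.toContinuousLinearMap
    { toFun := Mat.trace, map_add' := Mat.trace_add, map_smul' := Mat.trace_smul }

@[simp] lemma traceCLM_apply (X : Mat) : traceCLM X = X.trace := rfl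

lemma mul_add_mul_eq_trace_smul_one {R : Type*} [CommRing R] {X Y : Matrix (Fin 2) (Fin 2) R}
    (hX : X.trace = 0) (hY : Y.trace = 0) : X * Y + Y * X = (X * Y).trace • 1 := by
  rw [Matrix.trace_fin_two] at hX hY
  ext i j
  fin_cases i <;> fin_cases j <;>
    simp only [Matrix.add_apply, Matrix.smul_apply, Matrix.one_apply, Matrix.mul_apply,
      Matrix.trace_fin_two, Fin.sum_univ_two, Fin.zero_eta, Fin.mk_one, Fin.isValue, smul_eq_mul,
      reduceIte, zero_ne_one, one_ne_zero, mul_one, mul_zero]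
  · linear_combination X 0 0 * hY - Y 1 1 * hX
  · linear_combination X 0 1 * hY + Y 0 1 * hX
  · linear_combination X 1 0 * hY + Y 1 0 * hX
  · linear_combination -X 0 0 * hY + Y 1 1 * hX

lemma Mat.eq_zero_of_commute_of_trace_mul_eq_zero {X g : Mat} (hg : IsUnit g) (hcomm : Commute X g)
    (hX : X.trace = 0) (hg₀ : g.trace = 0) (hXg : (X * g).trace = 0) : X = 0 := by
  have hanti : X * g + g * X = (X * g).trace • (1 : Matrix (Fin 2) (Fin 2) ℂ) :=
    mul_add_mul_eq_trace_smul_one hX hg₀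
  have h2 : (2 : ℝ) • (X * g) = 0 := by
    rw [two_smul]
    exact (congrArg (X * g + ·) hcomm.eq).trans (hanti.trans (by rw [hXg, zero_smul]; rfl))
  exact hg.mul_left_eq_zero.1 ((smul_eq_zero.1 h2).resolve_left two_ne_zero)

lemma isUnit_of_mem_SU2 {g : Mat} (hg : g ∈ SU2) : IsUnit g :=
  ⟨⟨g, star g, mul_star_of_SU2 hg, star_mul_of_SU2 hg⟩, rfl⟩

open scoped Matrix.Norms.Operator in
lemma norm_le_two_of_mem_unitaryGroup {U : Matrix (Fin 2) (Fin 2) ℂ}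
    (hU : U ∈ Matrix.unitaryGroup (Fin 2) ℂ) : ‖U‖ ≤ 2 := by
  rw [Matrix.linfty_opNorm_def, ← NNReal.coe_ofNat, NNReal.coe_le_coe]
  refine Finset.sup_le fun i _ => ?_
  rw [← NNReal.coe_le_coe, Fin.sum_univ_two]
  push_cast
  linarith [entry_norm_bound_of_unitary hU i 0, entry_norm_bound_of_unitary hU i 1]

lemma norm_le_two_of_mem_SU2 {g : Mat} (hg : g ∈ SU2) : ‖g‖ ≤ 2 :=
  norm_le_two_of_mem_unitaryGroup (Matrix.mem_specialUnitaryGroup_iff.1 hg).1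

/-! ### Partial derivatives and the Laplacian -/

section Calculus

variable {E F : Type*} [NormedAddCommGroup E] [NormedSpace ℝ E] [NormedAddCommGroup F]
  [NormedSpace ℝ F]

lemma fderiv_fderiv_apply_comm {V : Type*} [NormedAddCommGroup V] [NormedSpace ℝ V] {u : V → E}
    (hu : ContDiff ℝ 2 u) (p v w : V) :
    fderiv ℝ (fun q => fderiv ℝ u q v) p w = fderiv ℝ (fun q => fderiv ℝ u q w) p v := by
  have happly : ∀ v w, fderiv ℝ (fun q => fderiv ℝ u q v) p w = fderiv ℝ (fderiv ℝ u) p w v := by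
    intro v w
    have hd := (hu.fderiv_right (m := 1) (by norm_num)).differentiable one_ne_zero p
    rw [(hd.hasFDerivAt.clm_apply (hasFDerivAt_const v p)).fderiv]
    simp
  rw [happly, happly, (hu.contDiffAt.isSymmSndFDerivAt (by simp)).eq]

/-- The partial derivative along the coordinate vector field `∂ᵢ`. -/
def partialDeriv (i : Fin 4) (u : Spacetime → E) (p : Spacetime) : E := fderiv ℝ u p (basisVec i)

/-- The Laplacian `∑ᵢ ∂ᵢ²` of the flat metric on space-time. -/
def laplacian (u : Spacetime → E) (p : Spacetime) : E :=
  ∑ i, partialDeriv i (partialDeriv i u) p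

lemma differentiable_partialDeriv {u : Spacetime → E} (hu : ContDiff ℝ 2 u) (i : Fin 4) :
    Differentiable ℝ (partialDeriv i u) :=
  ((hu.fderiv_right (m := 1) (by norm_num)).clm_apply contDiff_const).differentiable one_ne_zero

lemma partialDeriv_add {u v : Spacetime → E} (hu : Differentiable ℝ u) (hv : Differentiable ℝ v)
    (i : Fin 4) : partialDeriv i (u + v) = partialDeriv i u + partialDeriv i v := by
  funext p
  simp [partialDeriv, fderiv_add (hu p) (hv p)]

lemma partialDeriv_neg (u : Spacetime → E) (i : Fin 4) :
    partialDeriv i (-u) = -partialDeriv i u := by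
  funext p
  simp [partialDeriv, fderiv_neg]

lemma partialDeriv_sum {ι : Type*} {s : Finset ι} {u : ι → Spacetime → E}
    (hu : ∀ j ∈ s, Differentiable ℝ (u j)) (i : Fin 4) :
    partialDeriv i (∑ j ∈ s, u j) = ∑ j ∈ s, partialDeriv i (u j) := by
  funext p
  simp [partialDeriv, fderiv_sum fun j hj => hu j hj p]

lemma partialDeriv_comm {u : Spacetime → E} (hu : ContDiff ℝ 2 u) (i j : Fin 4) :
    partialDeriv i (partialDeriv j u) = partialDeriv j (partialDeriv i u) :=
  funext fun p => fderiv_fderiv_apply_comm hu p _ _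

lemma partialDeriv_clm_comp (L : E →L[ℝ] F) {u : Spacetime → E} (hu : Differentiable ℝ u)
    (i : Fin 4) : partialDeriv i (L ∘ u) = L ∘ partialDeriv i u := by
  funext p
  simp [partialDeriv, (L.hasFDerivAt.comp p (hu p).hasFDerivAt).fderiv]

lemma laplacian_add {u v : Spacetime → E} (hu : ContDiff ℝ 2 u) (hv : ContDiff ℝ 2 v) :
    laplacian (u + v) = laplacian u + laplacian v := by
  funext p
  simp only [laplacian, Pi.add_apply, ← Finset.sum_add_distrib]
  refine Finset.sum_congr rfl fun i _ => ?_
  rw [partialDeriv_add (hu.differentiable two_ne_zero) (hv.differentiable two_ne_zero),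
    partialDeriv_add (differentiable_partialDeriv hu i) (differentiable_partialDeriv hv i),
    Pi.add_apply]

lemma laplacian_clm_comp (L : E →L[ℝ] F) {u : Spacetime → E} (hu : ContDiff ℝ 2 u) :
    laplacian (L ∘ u) = L ∘ laplacian u := by
  funext p
  simp only [laplacian, Function.comp_apply, map_sum]
  refine Finset.sum_congr rfl fun i _ => ?_
  rw [partialDeriv_clm_comp L (hu.differentiable two_ne_zero),
    partialDeriv_clm_comp L (differentiable_partialDeriv hu i), Function.comp_apply]

lemma laplacian_const_mul_sq (ε : ℝ) (ℓ : Spacetime →L[ℝ] ℝ) (p : Spacetime) :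
    laplacian (fun p => ε * ℓ p ^ 2) p = 2 * ε * ∑ i, ℓ (basisVec i) ^ 2 := by
  have hfirst : ∀ i, partialDeriv i (fun p => ε * ℓ p ^ 2) =
      fun p => 2 * ε * ℓ (basisVec i) * ℓ p := by
    intro i
    funext p
    rw [partialDeriv, ((ℓ.hasFDerivAt.pow 2).const_mul ε).fderiv]
    simp only [Nat.add_one_sub_one, pow_one, nsmul_eq_mul, Nat.cast_ofNat, smul_apply, smul_eq_mul]
    ring
  rw [laplacian, Finset.mul_sum]
  refine Finset.sum_congr rfl fun i _ => ?_
  rw [hfirst, partialDeriv, (ℓ.hasFDerivAt.const_mul _).fderiv]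
  simp only [smul_apply, smul_eq_mul]
  ring

lemma deriv_comp_add_smul {u : Spacetime → E} (hu : Differentiable ℝ u) (p : Spacetime)
    (i : Fin 4) : deriv (fun s : ℝ => u (p + s • basisVec i)) =
      fun s => partialDeriv i u (p + s • basisVec i) := by
  funext s
  have hline : HasDerivAt (fun s : ℝ => p + s • basisVec i) (basisVec i) s := by
    simpa using ((hasDerivAt_id s).smul_const (basisVec i)).const_add p
  exact ((hu _).hasFDerivAt.comp_hasDerivAt s hline).deriv

end Calculus

/-! ### The maximum principle -/

lemma deriv_deriv_nonpos_of_isLocalMax {f : ℝ → ℝ} {x : ℝ} (hf : ContinuousAt f x)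
    (h : IsLocalMax f x) : deriv (deriv f) x ≤ 0 := by
  by_contra! hpos
  have hmin := isLocalMin_of_deriv_deriv_pos hpos h.deriv_eq_zero hf
  have hconst : f =ᶠ[𝓝 x] fun _ => f x := by
    filter_upwards [h, hmin] with y hle hge using le_antisymm hle hge
  rw [hconst.deriv.deriv_eq] at hpos
  simp at hpos

lemma laplacian_nonpos_of_isLocalMax {u : Spacetime → ℝ} (hu : ContDiff ℝ 2 u) {p : Spacetime}
    (h : IsLocalMax u p) : laplacian u p ≤ 0 := by
  refine Finset.sum_nonpos fun i _ => ?_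
  have hline : Continuous fun s : ℝ => p + s • basisVec i := by fun_prop
  have hmax : IsLocalMax (fun s : ℝ => u (p + s • basisVec i)) 0 :=
    IsLocalMax.comp_continuous (f := u) (by simpa using h) hline.continuousAt
  have hsecond : deriv (deriv fun s : ℝ => u (p + s • basisVec i)) 0 ≤ 0 :=
    deriv_deriv_nonpos_of_isLocalMax (hu.continuous.comp hline).continuousAt hmax
  rw [deriv_comp_add_smul (hu.differentiable two_ne_zero),
    deriv_comp_add_smul (differentiable_partialDeriv hu i)] at hsecond
  simpa using hsecond

lemma exists_isLocalMax_of_periodic {v : Spacetime → ℝ} (hv : Continuous v) {T R : ℝ} (hT : 0 < T)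
    (hper : ∀ t x, v (t + T, x) = v (t, x)) {p₀ : Spacetime} (hp₀ : ‖p₀.2‖ ≤ R)
    (hlt : ∀ p : Spacetime, ‖p.2‖ = R → v p < v p₀) : ∃ q, IsLocalMax v q := by
  let K : Set Spacetime := Set.Icc 0 T ×ˢ Metric.closedBall 0 R
  have hreduce : ∀ p : Spacetime, ‖p.2‖ ≤ R → ∃ q ∈ K, v p = v q := by
    intro p hp
    obtain ⟨t, ht, htv⟩ :=
      Function.Periodic.exists_mem_Ico₀ (f := fun t => v (t, p.2)) (fun t => hper t p.2) hT p.1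
    exact ⟨(t, p.2), ⟨⟨ht.1, ht.2.le⟩, by simpa using hp⟩, htv⟩
  obtain ⟨q₀, hq₀, hvq₀⟩ := hreduce p₀ hp₀
  obtain ⟨q, hqK, hqmax⟩ := (isCompact_Icc.prod (isCompact_closedBall _ _)).exists_isMaxOn
    (⟨q₀, hq₀⟩ : K.Nonempty) hv.continuousOn
  have hqR : ‖q.2‖ < R := lt_of_le_of_ne (by simpa using hqK.2) fun h =>
    (hlt q h).not_ge (hvq₀ ▸ hqmax hq₀)
  have hball : ∀ᶠ p : Spacetime in 𝓝 q, ‖p.2‖ < R :=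
    (continuous_snd.norm.tendsto q).eventually (gt_mem_nhds hqR)
  refine ⟨q, hball.mono fun p hp => ?_⟩
  obtain ⟨p', hp', hvp⟩ := hreduce p hp.le
  exact hvp ▸ hqmax hp'

lemma exists_forall_lt_of_tendsto_spatialInfinity {u : Spacetime → ℝ}
    (hlim : Tendsto u spatialInfinity (𝓝 0)) {c : ℝ} (hc : 0 < c) :
    ∃ R, ∀ p : Spacetime, R ≤ ‖p.2‖ → u p < c := by
  obtain ⟨R, hR⟩ := eventually_atTop.1 (eventually_comap.1 (hlim.eventually (gt_mem_nhds hc)))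
  exact ⟨R, fun p hp => hR _ hp p rfl⟩

lemma nonpos_of_subharmonic {u : Spacetime → ℝ} (hu : ContDiff ℝ 2 u) {T : ℝ} (hT : 0 < T)
    (hper : ∀ t x, u (t + T, x) = u (t, x)) (hΔ : ∀ p, 0 ≤ laplacian u p)
    (hlim : Tendsto u spatialInfinity (𝓝 0)) (p₀ : Spacetime) : u p₀ ≤ 0 := by
  by_contra! hpos
  obtain ⟨R, hR⟩ := exists_forall_lt_of_tendsto_spatialInfinity hlim (half_pos hpos)
  obtain ⟨ε, hε, hεR⟩ := exists_pos_mul_lt (half_pos hpos) (R ^ 2)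
  -- A small multiple of `x₀²` makes `u` strictly subharmonic, so a maximum is impossible.
  let ℓ : Spacetime →L[ℝ] ℝ :=
    (EuclideanSpace.proj (0 : Fin 3)).comp (ContinuousLinearMap.snd ℝ ℝ Space)
  have hsq : ContDiff ℝ 2 fun p => ε * ℓ p ^ 2 := contDiff_const.mul (ℓ.contDiff.pow 2)
  have hp₀ : ‖p₀.2‖ ≤ R := by
    by_contra! h
    linarith [hR p₀ h.le]
  have hsphere : ∀ p : Spacetime, ‖p.2‖ = R → u p + ε * ℓ p ^ 2 < u p₀ + ε * ℓ p₀ ^ 2 := by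
    intro p hp
    have hcoord : ℓ p ^ 2 ≤ R ^ 2 := sq_le_sq' (neg_le_of_abs_le (hp ▸ PiLp.norm_apply_le p.2 0))
      (le_of_abs_le (hp ▸ PiLp.norm_apply_le p.2 0))
    nlinarith [hR p hp.ge, mul_le_mul_of_nonneg_left hcoord hε.le, sq_nonneg (ℓ p₀)]
  obtain ⟨q, hq⟩ := exists_isLocalMax_of_periodic (v := u + fun p => ε * ℓ p ^ 2)
    (hu.add hsq).continuous hT (fun t x => by simp [hper, ℓ]) hp₀ hsphere
  have hmax : laplacian (u + fun p => ε * ℓ p ^ 2) q ≤ 0 :=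
    laplacian_nonpos_of_isLocalMax (hu.add hsq) hq
  have hℓ : ∑ i, ℓ (basisVec i) ^ 2 = 1 := by simp [Fin.sum_univ_succ, basisVec, ℓ]
  rw [laplacian_add hu hsq, Pi.add_apply, laplacian_const_mul_sq, hℓ] at hmax
  linarith [hΔ q]

lemma eq_zero_of_harmonic {E : Type*} [NormedAddCommGroup E] [NormedSpace ℝ E] {u : Spacetime → E}
    (hu : ContDiff ℝ 2 u) {T : ℝ} (hT : 0 < T) (hper : ∀ t x, u (t + T, x) = u (t, x))
    (hΔ : ∀ p, laplacian u p = 0) (hlim : Tendsto u spatialInfinity (𝓝 0)) (p : Spacetime) :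
    u p = 0 := by
  have hnonpos : ∀ L : E →L[ℝ] ℝ, L (u p) ≤ 0 := fun L =>
    nonpos_of_subharmonic (u := L ∘ u) (L.contDiff.comp hu) hT (fun t x => by simp [hper])
      (fun q => by simp [laplacian_clm_comp L hu, hΔ])
      (by simpa using (L.continuous.tendsto 0).comp hlim) p
  refine SeparatingDual.eq_zero_of_forall_dual_eq_zero (R := ℝ) fun L => le_antisymm (hnonpos L) ?_
  simpa using hnonpos (-L)

/-! ### Harmonic two-forms -/

section TwoForms

variable {E : Type*} [NormedAddCommGroup E] [NormedSpace ℝ E] {φ : Fin 4 → Fin 4 → Spacetime → E}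

lemma laplacian_eq_zero_of_closed_of_coclosed (hφ : ∀ i j, ContDiff ℝ 2 (φ i j))
    (hanti : ∀ i j, φ j i = -φ i j)
    (hclosed : ∀ i j k,
      partialDeriv i (φ j k) + partialDeriv j (φ k i) + partialDeriv k (φ i j) = 0)
    (hcoclosed : ∀ j, ∑ i, partialDeriv i (φ i j) = 0) (j k : Fin 4) :
    laplacian (φ j k) = 0 := by
  have hd : ∀ i j k, Differentiable ℝ (partialDeriv i (φ j k)) := fun i j k =>
    differentiable_partialDeriv (hφ j k) i
  have hcomm : ∀ i, partialDeriv i (partialDeriv i (φ j k)) =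
      partialDeriv j (partialDeriv i (φ i k)) + -partialDeriv k (partialDeriv i (φ i j)) := by
    intro i
    have hi : partialDeriv i (φ j k) = partialDeriv j (φ i k) + -partialDeriv k (φ i j) := by
      have h := hclosed i j k
      rw [hanti i k, partialDeriv_neg] at h
      rw [← sub_eq_zero, ← h]
      abel
    rw [hi, partialDeriv_add (hd j i k) (hd k i j).neg, partialDeriv_neg,
      partialDeriv_comm (hφ i k), partialDeriv_comm (hφ i j)]
  have hdiv : ∀ j k, ∑ i, partialDeriv j (partialDeriv i (φ i k)) = 0 := by
    intro j k
    rw [← partialDeriv_sum fun i _ => hd i i k, hcoclosed]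
    funext p
    simp [partialDeriv]
  calc laplacian (φ j k) = ∑ i, partialDeriv i (partialDeriv i (φ j k)) := by
        funext p
        rw [laplacian, Finset.sum_apply]
    _ = 0 := by
        simp only [hcomm, Finset.sum_add_distrib, Finset.sum_neg_distrib, hdiv, neg_zero, add_zero]

lemma sum_partialDeriv_eq_zero_of_asd (hanti : ∀ i j, φ j i = -φ i j)
    (h₁ : φ 2 3 = -φ 0 1) (h₂ : φ 3 1 = -φ 0 2) (h₃ : φ 1 2 = -φ 0 3)
    (hclosed : ∀ i j k,
      partialDeriv i (φ j k) + partialDeriv j (φ k i) + partialDeriv k (φ i j) = 0) (j : Fin 4) :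
    ∑ i, partialDeriv i (φ i j) = 0 := by
  have := IsAddTorsionFree.of_isTorsionFree ℝ E
  have hdiag : partialDeriv j (φ j j) = 0 := by
    rw [show φ j j = 0 from self_eq_neg.1 (hanti j j)]
    funext p
    simp [partialDeriv]
  fin_cases j <;>
    simp only [Fin.sum_univ_four, Fin.zero_eta, Fin.mk_one, Fin.reduceFinMk] at hdiag ⊢
  · have h := hclosed 1 2 3
    simp only [hanti 0 1, hanti 0 2, hanti 0 3, h₁, h₂, h₃, partialDeriv_neg] at h ⊢
    linear_combination (norm := abel) hdiag + h
  · have h := hclosed 0 2 3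
    simp only [hanti 1 2, hanti 0 3, h₁, h₂, h₃, partialDeriv_neg] at h ⊢
    linear_combination (norm := abel) hdiag - h
  · have h := hclosed 0 3 1
    simp only [hanti 2 3, hanti 0 1, h₁, h₂, h₃, partialDeriv_neg] at h ⊢
    linear_combination (norm := abel) hdiag - h
  · have h := hclosed 0 1 2
    simp only [hanti 3 1, hanti 0 2, h₁, h₂, h₃, partialDeriv_neg] at h ⊢
    linear_combination (norm := abel) hdiag - h

end TwoForms

/-! ### Connections, curvature and parallel endomorphisms -/

section Curvature

variable {A : Spacetime → Spacetime →L[ℝ] Mat} {X Y h : Spacetime → Mat}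

/-- The covariant derivative `∇ᵥX = ∂ᵥX + [A(v), X]` that the connection `d + A` induces on
endomorphisms. -/
def covDeriv (A : Spacetime → Spacetime →L[ℝ] Mat) (X : Spacetime → Mat) (p v : Spacetime) : Mat :=
  fderiv ℝ X p v + (A p v * X p - X p * A p v)

/-- An endomorphism is parallel if its covariant derivative vanishes. -/
def IsParallel (A : Spacetime → Spacetime →L[ℝ] Mat) (h : Spacetime → Mat) : Prop :=
  ∀ p v, covDeriv A h p v = 0

/-- The coefficient `tr (F(v, w) h)` of the complex two-form `tr (F h)`. -/
def traceForm (A : Spacetime → Spacetime →L[ℝ] Mat) (h : Spacetime → Mat) (v w p : Spacetime) : ℂ :=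
  (curvature A p v w * h p).trace

lemma fderiv_conn_apply (hA : ContDiff ℝ ∞ A) (p v w : Spacetime) :
    fderiv ℝ A p v w = fderiv ℝ (fun q => A q w) p v := by
  have hd := (hA.differentiable (by simp) p).hasFDerivAt.clm_apply (hasFDerivAt_const w p)
  rw [hd.fderiv]
  simp

lemma contDiff_conn_apply (hA : ContDiff ℝ ∞ A) (v : Spacetime) : ContDiff ℝ ∞ fun p => A p v :=
  hA.clm_apply contDiff_const

lemma contDiff_fderiv_apply (hX : ContDiff ℝ ∞ X) (v : Spacetime) :
    ContDiff ℝ ∞ fun p => fderiv ℝ X p v :=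
  (hX.fderiv_right (m := ∞) le_rfl).clm_apply contDiff_const

lemma curvature_eq (hA : ContDiff ℝ ∞ A) (v w : Spacetime) :
    (fun p => curvature A p v w) = fun p =>
      fderiv ℝ (fun q => A q w) p v - fderiv ℝ (fun q => A q v) p w +
        (A p v * A p w - A p w * A p v) := by
  funext p
  rw [curvature, fderiv_conn_apply hA, fderiv_conn_apply hA]

lemma contDiff_curvature (hA : ContDiff ℝ ∞ A) (v w : Spacetime) :
    ContDiff ℝ ∞ fun p => curvature A p v w := by
  have ha := contDiff_conn_apply hA
  rw [curvature_eq hA]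
  exact ((contDiff_fderiv_apply (ha w) v).sub (contDiff_fderiv_apply (ha v) w)).add
    (((ha v).mul (ha w)).sub ((ha w).mul (ha v)))

lemma curvature_antisymm (A : Spacetime → Spacetime →L[ℝ] Mat) (p v w : Spacetime) :
    curvature A p w v = -curvature A p v w := by
  simp only [curvature]
  abel

lemma curvature_periodic {T : ℝ} (hA : ∀ t x, A (t + T, x) = A (t, x)) (t : ℝ) (x : Space)
    (v w : Spacetime) : curvature A (t + T, x) v w = curvature A (t, x) v w := by
  have hshift : (fun p => A (p + ((T, 0) : Spacetime))) = A := by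
    funext ⟨s, y⟩
    simpa using hA s y
  have hderiv : fderiv ℝ A (t + T, x) = fderiv ℝ A (t, x) := by
    simpa [hshift] using
      (fderiv_comp_add_right (𝕜 := ℝ) (f := A) (x := (t, x)) ((T, 0) : Spacetime)).symm
  simp only [curvature, hderiv, hA]

lemma trace_fderiv (hX : Differentiable ℝ X) (p v : Spacetime) :
    (fderiv ℝ X p v).trace = fderiv ℝ (fun q => (X q).trace) p v := by
  have hd : HasFDerivAt (fun q => (X q).trace) _ p :=
    traceCLM.hasFDerivAt.comp p (hX p).hasFDerivAt
  simp [hd.fderiv]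

lemma trace_curvature (hA : ContDiff ℝ ∞ A) (htr : ∀ p v, (A p v).trace = 0) (p v w : Spacetime) :
    (curvature A p v w).trace = 0 := by
  have hderiv : ∀ v w, (fderiv ℝ A p v w).trace = 0 := by
    intro v w
    rw [fderiv_conn_apply hA,
      trace_fderiv ((contDiff_conn_apply hA w).differentiable (by simp))]
    simp [htr]
  simp [curvature, Mat.trace_add, Mat.trace_sub, hderiv, Mat.trace_mul_comm (A p v)]

lemma covDeriv_mul (hX : ContDiff ℝ ∞ X) (hY : ContDiff ℝ ∞ Y) (p v : Spacetime) :
    covDeriv A (fun q => X q * Y q) p v = covDeriv A X p v * Y p + X p * covDeriv A Y p v := by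
  simp only [covDeriv, fderiv_mul_mat hX hY]
  noncomm_ring

lemma trace_covDeriv (hX : Differentiable ℝ X) (p v : Spacetime) :
    (covDeriv A X p v).trace = fderiv ℝ (fun q => (X q).trace) p v := by
  rw [covDeriv, Mat.trace_add, Mat.trace_sub, Mat.trace_mul_comm (A p v), sub_self, add_zero,
    trace_fderiv hX]

lemma fderiv_add_commutator {a b c : Spacetime → Mat} (ha : ContDiff ℝ ∞ a) (hb : ContDiff ℝ ∞ b)
    (hc : ContDiff ℝ ∞ c) (p u : Spacetime) :
    fderiv ℝ (fun q => c q + (a q * b q - b q * a q)) p u = fderiv ℝ c p u +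
      (a p * fderiv ℝ b p u + fderiv ℝ a p u * b p -
        (b p * fderiv ℝ a p u + fderiv ℝ b p u * a p)) := by
  have hd : ∀ {f : Spacetime → Mat}, ContDiff ℝ ∞ f → DifferentiableAt ℝ f p :=
    fun hf => hf.differentiable (by simp) p
  rw [fderiv_fun_add (hd hc) (hd ((ha.mul hb).sub (hb.mul ha))),
    fderiv_fun_sub (hd (ha.mul hb)) (hd (hb.mul ha))]
  simp [fderiv_mul_mat ha hb, fderiv_mul_mat hb ha]

lemma covDeriv_covDeriv_sub (hA : ContDiff ℝ ∞ A) (hX : ContDiff ℝ ∞ X) (p v w : Spacetime) :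
    covDeriv A (fun q => covDeriv A X q w) p v - covDeriv A (fun q => covDeriv A X q v) p w =
      curvature A p v w * X p - X p * curvature A p v w := by
  have hfderiv : ∀ v w,
      fderiv ℝ (fun q => fderiv ℝ X q w + (A q w * X q - X q * A q w)) p v =
        fderiv ℝ (fun q => fderiv ℝ X q w) p v +
          (A p w * fderiv ℝ X p v + fderiv ℝ A p v w * X p -
            (X p * fderiv ℝ A p v w + fderiv ℝ X p v * A p w)) := fun v w => by
    rw [fderiv_conn_apply hA]
    exact fderiv_add_commutator (contDiff_conn_apply hA w) hX (contDiff_fderiv_apply hX w) p v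
  simp only [covDeriv, hfderiv, curvature]
  rw [fderiv_fderiv_apply_comm (contDiff_infty.1 hX 2) p w v]
  noncomm_ring

lemma bianchi (hA : ContDiff ℝ ∞ A) (p u v w : Spacetime) :
    covDeriv A (fun q => curvature A q v w) p u + covDeriv A (fun q => curvature A q w u) p v +
      covDeriv A (fun q => curvature A q u v) p w = 0 := by
  have ha := contDiff_conn_apply hA
  have hda : ∀ v w, ContDiff ℝ ∞ fun q => fderiv ℝ (fun r => A r w) q v := fun v w =>
    contDiff_fderiv_apply (ha w) v
  have hfderiv : ∀ u v w, fderiv ℝ (fun q => curvature A q v w) p u =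
      fderiv ℝ (fun q => fderiv ℝ (fun r => A r w) q v) p u -
          fderiv ℝ (fun q => fderiv ℝ (fun r => A r v) q w) p u +
        (A p v * fderiv ℝ A p u w + fderiv ℝ A p u v * A p w -
          (A p w * fderiv ℝ A p u v + fderiv ℝ A p u w * A p v)) := fun u v w => by
    rw [curvature_eq hA, fderiv_add_commutator (ha v) (ha w) ((hda v w).sub (hda w v)),
      fderiv_fun_sub ((hda v w).differentiable (by simp) p)
        ((hda w v).differentiable (by simp) p), fderiv_conn_apply hA, fderiv_conn_apply hA]
    rfl
  have hcomm : ∀ u v w, fderiv ℝ (fun q => fderiv ℝ (fun r => A r w) q v) p u =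
      fderiv ℝ (fun q => fderiv ℝ (fun r => A r w) q u) p v := fun u v w =>
    fderiv_fderiv_apply_comm (contDiff_infty.1 (ha w) 2) p v u
  simp only [covDeriv, hfderiv]
  rw [hcomm u v w, hcomm v w u, hcomm u w v]
  simp only [curvature]
  noncomm_ring

lemma IsParallel.commute_curvature (hpar : IsParallel A h) (hA : ContDiff ℝ ∞ A)
    (hh : ContDiff ℝ ∞ h) (p v w : Spacetime) : Commute (curvature A p v w) (h p) := by
  have hzero : ∀ v, (fun q => covDeriv A h q v) = fun _ => 0 := fun v => funext fun q => hpar q v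
  have hcomm := covDeriv_covDeriv_sub hA hh p v w
  rw [hzero, hzero] at hcomm
  exact sub_eq_zero.1 (by simpa [covDeriv] using hcomm.symm)

lemma IsParallel.trace_eq_trace (hpar : IsParallel A h) (hh : Differentiable ℝ h)
    (p q : Spacetime) : (h p).trace = (h q).trace := by
  have hd : Differentiable ℝ fun p => (h p).trace := traceCLM.differentiable.comp hh
  refine is_const_of_fderiv_eq_zero (𝕜 := ℝ) hd (fun p => ?_) p q
  refine ContinuousLinearMap.ext fun v => ?_
  rw [← trace_covDeriv (A := A) hh, hpar]
  exact traceCLM.map_zero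

lemma traceForm_antisymm (A : Spacetime → Spacetime →L[ℝ] Mat) (h : Spacetime → Mat)
    (v w : Spacetime) : traceForm A h w v = -traceForm A h v w := by
  funext p
  rw [traceForm, curvature_antisymm, neg_mul]
  exact traceCLM.map_neg _

lemma contDiff_traceForm (hA : ContDiff ℝ ∞ A) (hh : ContDiff ℝ ∞ h) (v w : Spacetime) :
    ContDiff ℝ ∞ (traceForm A h v w) :=
  traceCLM.contDiff.comp ((contDiff_curvature hA v w).mul hh)

lemma IsParallel.fderiv_traceForm (hpar : IsParallel A h) (hA : ContDiff ℝ ∞ A)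
    (hh : ContDiff ℝ ∞ h) (p u v w : Spacetime) :
    fderiv ℝ (traceForm A h v w) p u =
      (covDeriv A (fun q => curvature A q v w) p u * h p).trace := by
  have hF := contDiff_curvature hA v w
  have hd := trace_covDeriv (A := A) ((hF.mul hh).differentiable (by simp)) p u
  rwa [covDeriv_mul hF hh, hpar, mul_zero, add_zero, eq_comm] at hd

lemma IsParallel.traceForm_closed (hpar : IsParallel A h) (hA : ContDiff ℝ ∞ A)
    (hh : ContDiff ℝ ∞ h) (p u v w : Spacetime) :
    fderiv ℝ (traceForm A h v w) p u + fderiv ℝ (traceForm A h w u) p v +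
      fderiv ℝ (traceForm A h u v) p w = 0 := by
  simp only [hpar.fderiv_traceForm hA hh]
  rw [← Mat.trace_add, ← Mat.trace_add, ← add_mul, ← add_mul, bianchi hA, zero_mul]
  exact traceCLM.map_zero

lemma AntiSelfDual.laplacian_traceForm (hasd : AntiSelfDual A) (hpar : IsParallel A h)
    (hA : ContDiff ℝ ∞ A) (hh : ContDiff ℝ ∞ h) (i j : Fin 4) :
    laplacian (traceForm A h (basisVec i) (basisVec j)) = 0 := by
  let φ : Fin 4 → Fin 4 → Spacetime → ℂ := fun i j => traceForm A h (basisVec i) (basisVec j)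
  have hφ : ∀ i j, ContDiff ℝ 2 (φ i j) := fun i j =>
    contDiff_infty.1 (contDiff_traceForm hA hh _ _) 2
  have hanti : ∀ i j, φ j i = -φ i j := fun i j => traceForm_antisymm A h _ _
  have hclosed : ∀ i j k,
      partialDeriv i (φ j k) + partialDeriv j (φ k i) + partialDeriv k (φ i j) = 0 :=
    fun i j k => funext fun p => hpar.traceForm_closed hA hh p _ _ _
  have hdual : ∀ i j k, (∀ p, curvComp A i j p = -curvComp A 0 k p) → φ i j = -φ 0 k := by
    intro i j k hF
    funext p
    have hneg := traceCLM.map_neg (curvComp A 0 k p * h p)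
    rwa [← neg_mul, ← hF] at hneg
  exact laplacian_eq_zero_of_closed_of_coclosed hφ hanti hclosed
    (sum_partialDeriv_eq_zero_of_asd hanti (hdual 2 3 1 fun p => (hasd p).1)
      (hdual 3 1 2 fun p => (hasd p).2.1) (hdual 1 2 3 fun p => (hasd p).2.2) hclosed) i j

end Curvature

/-! ### Decay of the curvature -/

section Decay

variable {A B : Spacetime → Spacetime →L[ℝ] Mat}

/-- The connection `d + A` extends smoothly to the radial compactification, in the chart
`ballChart` of its interior. -/
def ExtendsToCompactification (A : Spacetime → Spacetime →L[ℝ] Mat) : Prop :=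
  ∃ B : Spacetime → Spacetime →L[ℝ] Mat, ContDiff ℝ ∞ B ∧
    ∀ q : Spacetime, ‖q.2‖ < 1 → B q = (A (ballChart q)).comp (fderiv ℝ ballChart q)

lemma curvature_pullback (hA : ContDiff ℝ ∞ A) {ψ : Spacetime → Spacetime} {q : Spacetime}
    (hψ : ContDiffAt ℝ ∞ ψ q) (hB : B =ᶠ[𝓝 q] fun q => (A (ψ q)).comp (fderiv ℝ ψ q))
    (v w : Spacetime) :
    curvature B q v w = curvature A (ψ q) (fderiv ℝ ψ q v) (fderiv ℝ ψ q w) := by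
  have hcomp : HasFDerivAt (fun q => A (ψ q)) ((fderiv ℝ A (ψ q)).comp (fderiv ℝ ψ q)) q :=
    ((hA.differentiable (by simp)) (ψ q)).hasFDerivAt.comp q
      (hψ.differentiableAt (by simp)).hasFDerivAt
  have hsecond : HasFDerivAt (fderiv ℝ ψ) (fderiv ℝ (fderiv ℝ ψ) q) q :=
    ((hψ.fderiv_right (m := ∞) le_rfl).differentiableAt (by simp)).hasFDerivAt
  have hsymm : fderiv ℝ (fderiv ℝ ψ) q v w = fderiv ℝ (fderiv ℝ ψ) q w v :=
    ((contDiffAt_infty.1 hψ 2).isSymmSndFDerivAt (by simp)).eq v w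
  simp only [curvature, hB.fderiv_eq.trans (hcomp.clm_comp hsecond).fderiv, hB.eq_of_nhds]
  simp [hsymm]

lemma norm_curvature_le (A : Spacetime → Spacetime →L[ℝ] Mat) (p v w : Spacetime) :
    ‖curvature A p v w‖ ≤ (2 * ‖fderiv ℝ A p‖ + 2 * ‖A p‖ ^ 2) * ‖v‖ * ‖w‖ := by
  have hmul : ∀ v w, ‖A p v * A p w‖ ≤ ‖A p‖ * ‖v‖ * (‖A p‖ * ‖w‖) := fun v w =>
    norm_mul_le_of_le ((A p).le_opNorm v) ((A p).le_opNorm w)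
  calc ‖curvature A p v w‖ ≤ (‖fderiv ℝ A p v w‖ + ‖fderiv ℝ A p w v‖) +
        (‖A p v * A p w‖ + ‖A p w * A p v‖) :=
      (norm_add_le _ _).trans (add_le_add (norm_sub_le _ _) (norm_sub_le _ _))
    _ ≤ (‖fderiv ℝ A p‖ * ‖v‖ * ‖w‖ + ‖fderiv ℝ A p‖ * ‖w‖ * ‖v‖) +
        (‖A p‖ * ‖v‖ * (‖A p‖ * ‖w‖) + ‖A p‖ * ‖w‖ * (‖A p‖ * ‖v‖)) :=
      add_le_add (add_le_add ((fderiv ℝ A p).le_opNorm₂ v w) ((fderiv ℝ A p).le_opNorm₂ w v))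
        (add_le_add (hmul v w) (hmul w v))
    _ = (2 * ‖fderiv ℝ A p‖ + 2 * ‖A p‖ ^ 2) * ‖v‖ * ‖w‖ := by ring

lemma exists_norm_curvature_le_of_isCompact (hA : ContDiff ℝ ∞ A) {K : Set Spacetime}
    (hK : IsCompact K) : ∃ M, ∀ q ∈ K, ∀ v w, ‖curvature A q v w‖ ≤ M * ‖v‖ * ‖w‖ := by
  have hcont : Continuous fun q => 2 * ‖fderiv ℝ A q‖ + 2 * ‖A q‖ ^ 2 :=
    (continuous_const.mul (hA.continuous_fderiv (by simp)).norm).add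
      (continuous_const.mul (hA.continuous.norm.pow 2))
  obtain ⟨M, hM⟩ := hK.bddAbove_image hcont.continuousOn
  refine ⟨M, fun q hq v w => (norm_curvature_le A q v w).trans ?_⟩
  gcongr
  exact hM ⟨q, hq, rfl⟩

lemma contDiffAt_ballChart {q : Spacetime} (hq : ‖q.2‖ < 1) : ContDiffAt ℝ ∞ ballChart q := by
  have hne : 1 - ‖q.2‖ ^ 2 ≠ 0 := by nlinarith [norm_nonneg q.2]
  have hsub : ContDiffAt ℝ ∞ (fun q : Spacetime => 1 - ‖q.2‖ ^ 2) q :=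
    contDiffAt_const.sub (contDiff_snd.norm_sq ℝ).contDiffAt
  exact contDiffAt_fst.prodMk ((hsub.inv hne).smul contDiffAt_snd)

lemma fderiv_ballChart {q : Spacetime} (hq : ‖q.2‖ < 1) (v : Spacetime) :
    fderiv ℝ ballChart q v = (v.1, (1 - ‖q.2‖ ^ 2)⁻¹ • v.2 +
      (2 * inner ℝ q.2 v.2 / (1 - ‖q.2‖ ^ 2) ^ 2) • q.2) := by
  have hne : 1 - ‖q.2‖ ^ 2 ≠ 0 := by nlinarith [norm_nonneg q.2]
  have hsnd : HasFDerivAt (fun q : Spacetime => q.2) (ContinuousLinearMap.snd ℝ ℝ Space) q :=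
    hasFDerivAt_snd
  have hinv := (hasDerivAt_inv hne).comp_hasFDerivAt q (hsnd.norm_sq.const_sub 1)
  have hchart : HasFDerivAt ballChart _ q := hasFDerivAt_fst.prodMk (hinv.smul hsnd)
  rw [hchart.fderiv]
  have hcoef : -((1 - ‖q.2‖ ^ 2) ^ 2)⁻¹ * -(2 * inner ℝ q.2 v.2) =
      2 * inner ℝ q.2 v.2 / (1 - ‖q.2‖ ^ 2) ^ 2 := by ring
  ext1
  · simp
  · simp [← hcoef]

lemma exists_pos_one_sub_sq_eq (r : ℝ) :
    ∃ s : ℝ, 0 < s ∧ s * (1 + r) ≤ 2 ∧ 1 - (s * r) ^ 2 = s := by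
  have hsq := Real.sq_sqrt (show 0 ≤ 1 + 4 * r ^ 2 by positivity)
  have hle : r ≤ √(1 + 4 * r ^ 2) := Real.le_sqrt_of_sq_le (by nlinarith)
  refine ⟨2 / (1 + √(1 + 4 * r ^ 2)), by positivity, ?_, ?_⟩
  · rw [div_mul_eq_mul_div, div_le_iff₀ (by positivity)]
    linarith
  · field_simp
    linear_combination hsq

lemma exists_ballChart_eq (p : Spacetime) :
    ∃ q, ‖q.2‖ < 1 ∧ ballChart q = p ∧ (1 - ‖q.2‖ ^ 2) * (1 + ‖p.2‖) ≤ 2 := by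
  obtain ⟨s, hs, hs2, hsr⟩ := exists_pos_one_sub_sq_eq ‖p.2‖
  have hnorm : 1 - ‖s • p.2‖ ^ 2 = s := by rw [norm_smul, Real.norm_of_nonneg hs.le, hsr]
  refine ⟨(p.1, s • p.2), by nlinarith [norm_nonneg (s • p.2)], ?_, by rwa [hnorm]⟩
  simp only [ballChart, hnorm, inv_smul_smul₀ hs.ne']

lemma exists_fderiv_ballChart_eq {q : Spacetime} (hq : ‖q.2‖ < 1) (v : Spacetime) :
    ∃ w : Space, fderiv ℝ ballChart q (v.1, w) = v ∧ ‖w‖ ≤ 3 * (1 - ‖q.2‖ ^ 2) * ‖v.2‖ := by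
  set s := 1 - ‖q.2‖ ^ 2 with hs
  have hs0 : 0 < s := by nlinarith [norm_nonneg q.2]
  -- Inverts the rank one perturbation of the identity in `fderiv_ballChart`.
  set c : ℝ := 2 * inner ℝ q.2 v.2 / (1 + ‖q.2‖ ^ 2) with hc
  have hcs : c * (2 - s) = 2 * inner ℝ q.2 v.2 := by
    rw [hc, hs]
    field_simp
    ring
  refine ⟨s • (v.2 - c • q.2), ?_, ?_⟩
  · have hcoef : 2 * inner ℝ q.2 (s • (v.2 - c • q.2)) / s ^ 2 = c := by
      rw [inner_smul_right, inner_sub_right, inner_smul_right, real_inner_self_eq_norm_sq,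
        div_eq_iff (by positivity), show ‖q.2‖ ^ 2 = 1 - s by linarith]
      linear_combination -s * hcs
    rw [fderiv_ballChart hq]
    simp only [← hs, hcoef, inv_smul_smul₀ hs0.ne', sub_add_cancel]
  · have hcq : ‖c • q.2‖ ≤ 2 * ‖v.2‖ := by
      rw [norm_smul, hc, norm_div, norm_mul, Real.norm_two,
        Real.norm_of_nonneg (by positivity : 0 ≤ 1 + ‖q.2‖ ^ 2), div_mul_eq_mul_div,
        div_le_iff₀ (by positivity)]
      have hinner : ‖inner ℝ q.2 v.2‖ * ‖q.2‖ ≤ ‖q.2‖ * ‖v.2‖ * ‖q.2‖ :=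
        mul_le_mul_of_nonneg_right (norm_inner_le_norm (𝕜 := ℝ) q.2 v.2) (norm_nonneg q.2)
      nlinarith [norm_nonneg v.2]
    calc ‖s • (v.2 - c • q.2)‖ = s * ‖v.2 - c • q.2‖ := by
          rw [norm_smul, Real.norm_of_nonneg hs0.le]
      _ ≤ s * (‖v.2‖ + 2 * ‖v.2‖) := by
          gcongr
          exact (norm_sub_le _ _).trans (by gcongr)
      _ = 3 * s * ‖v.2‖ := by ring

lemma ExtendsToCompactification.exists_norm_curvature_le (hext : ExtendsToCompactification A)
    (hA : ContDiff ℝ ∞ A) (T : ℝ) : ∃ C, ∀ p : Spacetime, p.1 ∈ Set.Icc 0 T →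
      ∀ (v : Spacetime) (e : Space), ‖curvature A p v (0, e)‖ ≤ C * ‖v‖ * ‖e‖ / (1 + ‖p.2‖) := by
  obtain ⟨B, hB, hAB⟩ := hext
  obtain ⟨M, hM⟩ := exists_norm_curvature_le_of_isCompact hB
    ((isCompact_Icc (a := (0 : ℝ)) (b := T)).prod (isCompact_closedBall (0 : Space) 1))
  refine ⟨|M| * 18, fun p hp v e => ?_⟩
  obtain ⟨q, hq, rfl, hqp⟩ := exists_ballChart_eq p
  obtain ⟨v', hv', hv'_le⟩ := exists_fderiv_ballChart_eq hq v
  obtain ⟨w, hw, hw_le⟩ := exists_fderiv_ballChart_eq hq (0, e)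
  set s := 1 - ‖q.2‖ ^ 2
  have hpull := curvature_pullback hA (contDiffAt_ballChart hq)
    (((continuous_snd.norm.tendsto q).eventually (gt_mem_nhds hq)).mono hAB) (v.1, v') (0, w)
  rw [hv', hw] at hpull
  have hs1 : s ≤ 1 := sub_le_self _ (by positivity)
  have hv_le : ‖((v.1, v') : Spacetime)‖ ≤ 3 * ‖v‖ := by
    have := norm_fst_le v
    have := norm_snd_le v
    refine max_le (by linarith [norm_nonneg v]) (hv'_le.trans ?_)
    nlinarith [norm_nonneg v.2]
  have hw_le' : ‖((0, w) : Spacetime)‖ ≤ 3 * (2 / (1 + ‖(ballChart q).2‖)) * ‖e‖ := by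
    rw [Prod.norm_mk, norm_zero, max_eq_right (norm_nonneg w)]
    refine hw_le.trans ?_
    gcongr
    rwa [le_div_iff₀ (by positivity)]
  calc ‖curvature A (ballChart q) v (0, e)‖ = ‖curvature B q (v.1, v') (0, w)‖ := by rw [hpull]
    _ ≤ M * ‖((v.1, v') : Spacetime)‖ * ‖((0, w) : Spacetime)‖ :=
        hM q ⟨hp, by simpa using hq.le⟩ _ _
    _ ≤ |M| * (3 * ‖v‖) * (3 * (2 / (1 + ‖(ballChart q).2‖)) * ‖e‖) := by
        gcongr
        exact le_abs_self M
    _ = |M| * 18 * ‖v‖ * ‖e‖ / (1 + ‖(ballChart q).2‖) := by ring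

lemma ExtendsToCompactification.tendsto_curvature (hext : ExtendsToCompactification A)
    (hA : ContDiff ℝ ∞ A) {T : ℝ} (hT : 0 < T) (hper : ∀ t x, A (t + T, x) = A (t, x))
    (v : Spacetime) (e : Space) :
    Tendsto (fun p => curvature A p v (0, e)) spatialInfinity (𝓝 0) := by
  obtain ⟨C, hC⟩ := hext.exists_norm_curvature_le hA T
  have hbound : ∀ p : Spacetime, ‖curvature A p v (0, e)‖ ≤ C * ‖v‖ * ‖e‖ / (1 + ‖p.2‖) := by
    intro p
    have hperiodic : Function.Periodic (fun t => curvature A (t, p.2) v (0, e)) T := fun t =>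
      curvature_periodic hper t _ _ _
    obtain ⟨t, ht, heq⟩ := hperiodic.exists_mem_Ico₀ hT p.1
    exact (congrArg norm heq).trans_le (hC (t, p.2) ⟨ht.1, ht.2.le⟩ v e)
  refine squeeze_zero_norm hbound ?_
  exact (tendsto_atTop_add_const_left _ 1 tendsto_comap).const_div_atTop _

lemma ExtendsToCompactification.tendsto_curvComp (hext : ExtendsToCompactification A)
    (hA : ContDiff ℝ ∞ A) {T : ℝ} (hT : 0 < T) (hper : ∀ t x, A (t + T, x) = A (t, x))
    (i j : Fin 4) : Tendsto (curvComp A i j) spatialInfinity (𝓝 0) := by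
  have hsucc : ∀ (i : Fin 4) (j : Fin 3), Tendsto (curvComp A i j.succ) spatialInfinity (𝓝 0) :=
    fun i j => hext.tendsto_curvature hA hT hper _ _
  cases j using Fin.cases with
  | succ j => exact hsucc i j
  | zero =>
    cases i using Fin.cases with
    | zero =>
      have hzero : curvComp A 0 0 = fun _ => 0 := by
        funext p
        simp [curvComp, curvature]
      exact hzero ▸ tendsto_const_nhds
    | succ i =>
      have hneg : curvComp A i.succ 0 = fun p => -curvComp A 0 i.succ p :=
        funext fun p => curvature_antisymm A p _ _
      rw [hneg]
      simpa only [neg_zero] using (hsucc 0 i).neg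

end Decay

/-! ### Antiperiodic symmetries and flatness -/

section Antiperiodic

variable {A B : Spacetime → Spacetime →L[ℝ] Mat} {g h : Spacetime → Mat} {T : ℝ}

/-- A gauge transformation that preserves `d + A` and changes sign under `t ↦ t + T`. It is an
automorphism of the connection over the circle of length `2T` only. -/
structure IsAntiperiodicSymmetry (T : ℝ) (A : Spacetime → Spacetime →L[ℝ] Mat)
    (h : Spacetime → Mat) : Prop where
  smooth : ContDiff ℝ ∞ h
  mem_SU2 : ∀ p, h p ∈ SU2
  parallel : IsParallel A h
  antiperiodic : ∀ t x, h (t + T, x) = -h (t, x)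

lemma IsAntiperiodicSymmetry.trace_eq_zero (hh : IsAntiperiodicSymmetry T A h) (p : Spacetime) :
    (h p).trace = 0 := by
  refine neg_eq_self.1 ?_
  calc -(h p).trace = (h (p.1 + T, p.2)).trace := by
        rw [hh.antiperiodic]
        exact (traceCLM.map_neg _).symm
    _ = (h p).trace := hh.parallel.trace_eq_trace (hh.smooth.differentiable (by simp)) _ _

lemma tendsto_traceForm (hU : ∀ p, h p ∈ SU2) {v w : Spacetime}
    (hF : Tendsto (fun p => curvature A p v w) spatialInfinity (𝓝 0)) :
    Tendsto (traceForm A h v w) spatialInfinity (𝓝 0) := by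
  have hmul : Tendsto (fun p => curvature A p v w * h p) spatialInfinity (𝓝 0) := by
    refine squeeze_zero_norm (a := fun p => ‖curvature A p v w‖ * 2)
      (fun p => norm_mul_le_of_le le_rfl (norm_le_two_of_mem_SU2 (hU p))) ?_
    simpa only [norm_zero, zero_mul] using hF.norm.mul_const 2
  exact (map_zero traceCLM) ▸ (traceCLM.continuous.tendsto 0).comp hmul

lemma traceForm_periodic (hper : ∀ t x, A (t + T, x) = A (t, x))
    (hanti : ∀ t x, h (t + T, x) = -h (t, x)) (v w : Spacetime) (t : ℝ) (x : Space) :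
    traceForm A h v w (t + (T + T), x) = traceForm A h v w (t, x) := by
  simp only [traceForm, ← add_assoc, curvature_periodic hper, hanti, neg_neg]

theorem IsAntiperiodicSymmetry.curvComp_eq_zero (hh : IsAntiperiodicSymmetry T A h) (hT : 0 < T)
    (hA : ContDiff ℝ ∞ A) (htr : ∀ p v, (A p v).trace = 0) (hper : ∀ t x, A (t + T, x) = A (t, x))
    (hasd : AntiSelfDual A) (hext : ExtendsToCompactification A) (i j : Fin 4) :
    curvComp A i j = 0 := by
  have hform : ∀ p, traceForm A h (basisVec i) (basisVec j) p = 0 :=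
    eq_zero_of_harmonic (contDiff_infty.1 (contDiff_traceForm hA hh.smooth _ _) 2) (add_pos hT hT)
      (traceForm_periodic hper hh.antiperiodic _ _)
      (congrFun (hasd.laplacian_traceForm hh.parallel hA hh.smooth i j))
      (tendsto_traceForm hh.mem_SU2 (hext.tendsto_curvComp hA hT hper i j))
  funext p
  exact Mat.eq_zero_of_commute_of_trace_mul_eq_zero (isUnit_of_mem_SU2 (hh.mem_SU2 p))
    (hh.parallel.commute_curvature hA hh.smooth p _ _) (trace_curvature hA htr p _ _)
    (hh.trace_eq_zero p) (hform p)

lemma IsParallel.of_gaugeTakes (hg : ContDiff ℝ ∞ g) (hh : ContDiff ℝ ∞ h) (hgU : ∀ p, g p ∈ SU2)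
    (hhU : ∀ p, h p ∈ SU2) (hA : ∀ p v, star (A p v) = -A p v)
    (hB : ∀ p v, star (B p v) = -B p v) (hgAB : GaugeTakes g A B) (hhAB : GaugeTakes h A B) :
    IsParallel A fun p => star (g p) * h p := by
  intro p v
  rw [covDeriv, fderiv_mul_mat (contDiff_star hg) hh, fderiv_star_mat hg,
    (gaugeTakes_iff hgU).1 hgAB, (gaugeTakes_iff hhU).1 hhAB]
  simp only [star_sub, star_mul, hA, hB]
  noncomm_ring

end Antiperiodic

lemma period_pos {μ₀ : ℝ} (hμ₀ : 0 < μ₀) : 0 < period μ₀ := div_pos Real.two_pi_pos hμ₀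

lemma largeGauge_antiperiodic {μ₀ : ℝ} (hμ₀ : μ₀ ≠ 0) (t : ℝ) (x : Space) :
    largeGauge μ₀ (t + period μ₀, x) = -largeGauge μ₀ (t, x) := by
  have hπ : μ₀ / 2 * period μ₀ = Real.pi := by
    unfold period
    field_simp
  rw [largeGauge, mul_add, diagPhase_add, hπ, diagPhase_pi, mul_neg_one, largeGauge]

lemma FramedConnection.pullback_id_conn {μ₀ : ℝ} (a : FramedConnection μ₀) {K : Mat}
    (hK : K ∈ SU2) : (a.pullback EuclideanIsometry.id K hK).conn = a.conn := by
  refine funext fun p => ContinuousLinearMap.ext fun v => ?_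
  simp [pullback, EuclideanIsometry.id, EuclideanIsometry.toFun, EuclideanIsometry.lin,
    EuclideanIsometry.sgn]

lemma exists_isAntiperiodicSymmetry_of_fixed {μ₀ : ℝ} (hμ₀ : μ₀ ≠ 0) {θ : ℝ}
    {a : FramedConnection μ₀}
    (hfix : (phase μ₀ θ * rotation μ₀) (⟦a⟧ : ModuliSpace μ₀) = ⟦a⟧) :
    ∃ h, IsAntiperiodicSymmetry (period μ₀) a.conn h := by
  have hequiv : GaugeEquiv a
      (a.rotate.pullback EuclideanIsometry.id (diagPhase θ) (diagPhase_mem θ)) :=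
    GaugeEquiv.symm (Quotient.exact hfix)
  obtain ⟨g, hg, hgU, hper, hgauge, -⟩ := hequiv
  rw [FramedConnection.pullback_id_conn] at hgauge
  have hc := largeGauge_contDiff μ₀
  have hcU := largeGauge_mem μ₀
  exact ⟨fun p => star (largeGauge μ₀ p) * g p,
    { smooth := (contDiff_star hc).mul hg
      mem_SU2 := fun p => mul_mem (star_mem_SU2 (hcU p)) (hgU p)
      parallel := .of_gaugeTakes hc hg hcU hgU (fun p v => (a.conn_su2 p v).1)
        (fun p v => (a.rotate.conn_su2 p v).1) a.rotate_gaugeTakes hgauge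
      antiperiodic := fun t x => by
        simp only [largeGauge_antiperiodic hμ₀, hper, star_neg, neg_mul] }⟩

lemma BoundaryCondition.extendsToCompactification {μ₀ : ℝ} {a : FramedConnection μ₀}
    (ha : BoundaryCondition a) : ExtendsToCompactification a.conn :=
  let ⟨B, hB, hAB, _⟩ := ha
  ⟨B, hB, hAB⟩

lemma charge_eq_zero {A : Spacetime → Spacetime →L[ℝ] Mat} (μ₀ : ℝ)
    (hA : ∀ i j, curvComp A i j = 0) : charge μ₀ A = 0 := by
  have hdensity : ∀ p, chernDensity A p = 0 := fun p => by
    simp [chernDensity, hA, ← traceCLM_apply]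
  simp [charge, hdensity]

end Caloron

end

theorem proposition3p1_general {μ₀ : ℝ} (hμ₀ : 0 < μ₀) {a : Caloron.FramedConnection μ₀}
    (hasd : Caloron.AntiSelfDual a.conn) (hext : Caloron.ExtendsToCompactification a.conn) {θ : ℝ}
    (hfix : (Caloron.phase μ₀ θ * Caloron.rotation μ₀) (⟦a⟧ : Caloron.ModuliSpace μ₀) = ⟦a⟧)
    (i j : Fin 4) : Caloron.curvComp a.conn i j = 0 := by
  obtain ⟨h, hh⟩ := Caloron.exists_isAntiperiodicSymmetry_of_fixed hμ₀.ne' hfix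
  exact hh.curvComp_eq_zero (Caloron.period_pos hμ₀) a.conn_smooth (fun p v => (a.conn_su2 p v).2)
    a.conn_periodic hasd hext i j

theorem proposition3p1 (μ₀ : ℝ) (hμ₀ : 0 < μ₀) (k : ℕ) (hk : 0 < k)
    (H : Subgroup (Equiv.Perm (Caloron.ModuliSpace μ₀))) (hH : H ≤ Caloron.symmetryGroup μ₀)
    (θ : ℝ) (hθ : Caloron.phase μ₀ θ * Caloron.rotation μ₀ ∈ H) :
    Caloron.symmetricCalorons μ₀ k H = ∅ := by
  refine Set.eq_empty_of_forall_notMem ?_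
  rintro _ ⟨⟨a, ha, rfl⟩, hfix⟩
  have hcharge : Caloron.charge μ₀ a.conn = 0 := Caloron.charge_eq_zero μ₀
    (proposition3p1_general hμ₀ ha.asd ha.boundary.extendsToCompactification (hfix _ hθ))
  exact hk.ne' (Nat.cast_eq_zero.1 (ha.charge_eq.symm.trans hcharge))
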